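/- Let $p$ be a prime and $F=\mathbb{C}_p^\flat$, with absolute value $|x|_F=|x^\sharp|_{\mathbb{C}_p}$, $|p|_{\mathbb{C}_p}=1/p$, valuation ring $\mathcal{O}_F$ and maximal ideal $\mathfrak{m}_F$. Let $B$ be the Fargues–Fontaine ring of $(F,\mathbb{Q}_p)$, i.e. the completion of $W(\mathcal{O}_F)[1/p,1/[\varpi]]$ for the Gauss norms $|\sum_n [x_n]p^n|_\rho=\sup_n |x_n|_F\,\rho^n$, $\rho\in(0,1)$, with Frobenius $\varphi$. For a point $y$ of degree one, given by an ideal $\wp=([a]-p)\subset W(\mathcal{O}_F)$ with $0<|a|_F<1$, let $K_y$ be its residue field, $\eta_y:W(\mathcal{O}_F)\to\mathcal{O}_{K_y}$ the quotient map and $T_y=\{\log[u] : u\in 1+\mathfrak{m}_F,\ \eta_y([u])=1\}\subset B^{\varphi=p}$ its Tate module. For $n\ge 1$ let $$\Sigma_F=\{([a]-p,[a^{2^2}]-p,\dots,[a^{n^2}]-p) : a\in\mathfrak{m}_F\setminus\{0\}\}.$$ Let $E\subset\overline{\mathbb{Q}}_p$ be a finite extension of $\mathbb{Q}_p$, $G_E$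 its absolute Galois group, and $C/E$ a Tate elliptic curve with Tate parameter $q$. Let $\ell\ge 3$ be a prime, $\ell\ne p$, put $\ell^*=\frac{\ell-1}{2}$, and assume that $E$ contains a $2\ell$-th root $q^{1/2\ell}$ of $q$ and a primitive $\ell$-th root of unity $\zeta_\ell$. Let $\vartheta(u)=\sum_{n\in\mathbb{Z}}(-1)^n q^{n(n+1)/2}u^{2n+1}$, and let $\xi_1\in E$ be the theta value, given by $\xi_1^{-1}=\vartheta(q^{1/2\ell}\zeta_\ell)/\vartheta(\zeta_\ell)$ or by $\xi_1^{-1}=-q^{-1/2\ell}\zeta_\ell^{-2}$ (two normalizations that differ by a unit; the statement holds for either). For each point $y$ of degree one fix an embedding of valued fields $E\hookrightarrow K_y$. The lifts of $\xi_1$ over a tuple $(y_1,\dots,y_{\ell^*})$ are the tuples $([x_j]+\tau_j)_j\in B^{\ell^*}$ with $x_j\in\mathcal{O}_F$, $\eta_{y_j}([x_j])=\xi_1$ and $\tau_j\in T_{y_j}$. Let $\mathrm{Aut}(G_E\curvearrowright\mathscr{G}(\mathcal{O}_F))$ be the group of topological automorphisms $f$ of $B^{\varphi=p}\cong\mathscr{G}(\mathcal{O}_F)$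 for which there is an automorphism $\alpha$ of the topological group $G_E$ with $f(\sigma v)=\alpha(\sigma)f(v)$. Such an $f$ moves a point $y$ to the point $y'$ with $T_{y'}=f(T_y)$, and a lift $([x_j]+\tau_j)_j$ of $\xi_1$ over $(y_j)$ to every lift $([x'_j]+f(\tau_j))_j$ of $\xi_1$ over $(y'_j)$. Let $\widetilde\Theta\subset B^{\ell^*}$ be the smallest subset that contains all lifts of $\xi_1$ over the tuples in $\Sigma_F$ (with $n=\ell^*$) and is stable under $G_E$ and under $\mathrm{Aut}(G_E\curvearrowright\mathscr{G}(\mathcal{O}_F))$. Put $$|\widetilde\Theta|_B=\sup_{\rho\in(0,1)}\ \sup_{z\in\widetilde\Theta}\ \prod_{j=1}^{\ell^*}|z_j|_\rho\in[0,\infty].$$ Then, if $\ell$ is sufficiently large (larger than an absolute constant), $$|\widetilde\Theta|_B\ \ge\ |q^{1/2\ell}|_{\mathbb{C}_p}^{\ell^*}.$$ -/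

import Mathlib

open scoped NNReal

namespace FarguesFontaine
noncomputable section

section GaussNormWitt

open MvPolynomial

/-- Give the variable `X_(i,k)` weight `p ^ k`. If `Φ` is homogeneous of degree one, then the `n`-th
polynomial of the Witt vector operation attached to `Φ` is homogeneous of weight `p ^ n`. -/
theorem isWeightedHomogeneous_wittStructureRat (p : ℕ) [Fact p.Prime] {idx : Type*}
    {Φ : MvPolynomial idx ℚ} (hΦ : Φ.IsHomogeneous 1) (n : ℕ) :
    (wittStructureRat p Φ n).IsWeightedHomogeneous (fun x : idx × ℕ => p ^ x.2) (p ^ n) := by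
  induction n using Nat.strong_induction_on with
  | _ n ih =>
    rw [wittStructureRat_rec]
    refine IsWeightedHomogeneous.C_mul (IsWeightedHomogeneous.sub ?_ ?_) _
    · have hW : ∀ b : idx, (rename (fun i => (b, i)) (wittPolynomial p ℚ n)).IsWeightedHomogeneous
          (fun x : idx × ℕ => p ^ x.2) (p ^ n) := by
        intro b
        rw [wittPolynomial_eq_sum_C_mul_X_pow, map_sum]
        refine IsWeightedHomogeneous.sum _ _ _ fun i hi => ?_
        rw [map_mul, map_pow (rename _) (X i), rename_C, rename_X]
        refine IsWeightedHomogeneous.C_mul ?_ _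
        have h := (isWeightedHomogeneous_X ℚ (fun x : idx × ℕ => p ^ x.2) (b, i)).pow (p ^ (n - i))
        have hin : i ≤ n := Nat.lt_succ_iff.mp (Finset.mem_range.mp hi)
        rwa [smul_eq_mul, ← pow_add, Nat.sub_add_cancel hin] at h
      rw [bind₁, aeval_def, eval₂_eq]
      refine IsWeightedHomogeneous.sum _ _ _ fun d hd => ?_
      refine IsWeightedHomogeneous.C_mul ?_ _
      have h := IsWeightedHomogeneous.prod d.support
        (fun b => (rename (fun i => (b, i)) (wittPolynomial p ℚ n)) ^ d b)
        (fun b => d b • p ^ n) (w := fun x : idx × ℕ => p ^ x.2) fun b _ => (hW b).pow _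
      have hdeg := hΦ (mem_support_iff.mp hd)
      rw [← Finset.sum_smul] at h
      have : ∑ i ∈ d.support, d i = 1 := by
        simpa [Finsupp.weight_apply, Finsupp.sum] using hdeg
      rwa [this, one_smul] at h
    · refine IsWeightedHomogeneous.sum _ _ _ fun i hi => ?_
      refine IsWeightedHomogeneous.C_mul ?_ _
      have hin := Finset.mem_range.mp hi
      have h := (ih i hin).pow (p ^ (n - i))
      rwa [smul_eq_mul, ← pow_add, Nat.sub_add_cancel hin.le] at h

theorem isWeightedHomogeneous_wittSub (p : ℕ) [Fact p.Prime] (n : ℕ) :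
    (WittVector.wittSub p n).IsWeightedHomogeneous (fun x : Fin 2 × ℕ => p ^ x.2) (p ^ n) := by
  have h := isWeightedHomogeneous_wittStructureRat p (idx := Fin 2)
    (Φ := map (Int.castRingHom ℚ) (X 0 - X 1)) (by
      rw [map_sub, map_X, map_X]
      exact (isHomogeneous_X ℚ 0).sub (isHomogeneous_X ℚ 1)) n
  rw [← map_wittStructureInt] at h
  intro d hd
  refine h (d := d) ?_
  rw [coeff_map, eq_intCast, Int.cast_ne_zero]
  exact hd

variable {p : ℕ} [Fact p.Prime] {R : Type*} [CommRing R]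

/-- The non-archimedean estimate for the Witt coordinates of a difference. -/
theorem valuation_coeff_sub_le (v : Valuation R ℝ≥0) (hv : ∀ x, v x ≤ 1) (a b : WittVector p R)
    (n : ℕ) (M : ℝ≥0) (ha : ∀ i ≤ n, v (a.coeff i) ≤ M ^ p ^ i)
    (hb : ∀ i ≤ n, v (b.coeff i) ≤ M ^ p ^ i) : v ((a - b).coeff n) ≤ M ^ p ^ n := by
  have hp1 : 1 < p := (Fact.out : p.Prime).one_lt
  rw [WittVector.sub_coeff, WittVector.peval, aeval_def, eval₂_eq]
  refine Valuation.map_sum_le _ fun d hd => ?_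
  rw [map_mul, map_prod]
  have hdeg := isWeightedHomogeneous_wittSub p n (mem_support_iff.mp hd)
  rw [Finsupp.weight_apply, Finsupp.sum] at hdeg
  refine (mul_le_of_le_one_left' (hv _)).trans ?_
  rw [← hdeg, ← Finset.prod_pow_eq_pow_sum]
  refine Finset.prod_le_prod' fun x hx => ?_
  have hx0 : d x ≠ 0 := Finsupp.mem_support_iff.mp hx
  have hxn : x.2 ≤ n := by
    have h1 : p ^ x.2 ≤ p ^ n := by
      rw [← hdeg]
      refine le_trans ?_ (Finset.single_le_sum (fun i _ => Nat.zero_le _) hx)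
      simpa using Nat.le_mul_of_pos_left (p ^ x.2) (Nat.pos_of_ne_zero hx0)
    exact (Nat.pow_le_pow_iff_right hp1).mp h1
  rw [map_pow, smul_eq_mul, mul_comm, pow_mul]
  refine pow_le_pow_left' ?_ _
  obtain ⟨i, k⟩ := x
  fin_cases i
  · exact ha k hxn
  · exact hb k hxn


theorem coeff_sum_teichmuller [CharP R p] (z : ℕ → R) (n k : ℕ) (hk : k ≤ n) :
    (∑ i ∈ Finset.Iic n, WittVector.teichmuller p (z i) * (p : WittVector p R) ^ i).coeff k
      = z k ^ p ^ k := by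
  rw [WittVector.sum_coeff_eq_coeff_sum]
  · rw [Finset.sum_eq_single k]
    · exact WittVector.teichmuller_mul_pow_coeff k (z k)
    · intro b _ hb
      exact WittVector.teichmuller_mul_pow_coeff_of_ne _ hb.symm
    · intro h; exact absurd (Finset.mem_Iic.mpr hk) h
  · refine fun m => ⟨fun ⟨a, _, ha⟩ ⟨b, _, hb⟩ => ?_⟩
    ext
    have h1 : m = a := by
      by_contra h; exact ha (WittVector.teichmuller_mul_pow_coeff_of_ne _ h)
    have h2 : m = b := by
      by_contra h; exact hb (WittVector.teichmuller_mul_pow_coeff_of_ne _ h)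
    exact h1.symm.trans h2

variable [CharP R p] [PerfectRing R p]

/-- The elements `x_n` of a perfect ring `R` in the expansion `a = ∑ [x_n] p ^ n` of a Witt vector. -/
def teichCoord (a : WittVector p R) (n : ℕ) : R :=
  (frobeniusEquiv R p).symm^[n] (a.coeff n)

theorem teichCoord_pow (a : WittVector p R) (n : ℕ) : teichCoord a n ^ p ^ n = a.coeff n := by
  rw [teichCoord, ← iterate_frobenius]
  exact Function.LeftInverse.iterate (f := (frobeniusEquiv R p).symm) (g := frobenius R p)
    (frobenius_apply_frobeniusEquiv_symm R p) n (a.coeff n)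

theorem teichCoord_eq_iff (a : WittVector p R) (n : ℕ) (x : R) :
    teichCoord a n = x ↔ a.coeff n = x ^ p ^ n := by
  rw [← teichCoord_pow]
  constructor
  · rintro rfl; rfl
  · intro h
    rw [← iterate_frobenius, ← iterate_frobenius] at h
    exact (Function.Injective.iterate (PerfectRing.bijective_frobenius (R := R) (p := p)).1 n) h

theorem dvd_sub_iff_coeff_eq (a b : WittVector p R) (n : ℕ) :
    (p : WittVector p R) ^ (n + 1) ∣ a - b ↔ ∀ k ≤ n, a.coeff k = b.coeff k := by
  rw [← Ideal.mem_span_singleton, WittVector.mem_span_p_pow_iff_le_coeff_eq_zero,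
    ← WittVector.le_coeff_eq_iff_le_sub_coeff_eq_zero]
  exact forall_congr' fun k => by rw [Nat.lt_succ_iff]

theorem dvd_sub_sum_teichCoord (a : WittVector p R) (n : ℕ) : (p : WittVector p R) ^ (n + 1) ∣
    a - ∑ i ∈ Finset.Iic n, WittVector.teichmuller p (teichCoord a i) * (p : WittVector p R) ^ i := by
  rw [dvd_sub_iff_coeff_eq]
  intro k hk
  rw [coeff_sum_teichmuller _ n k hk, teichCoord_pow]

theorem teichCoord_teichmuller_mul (x : R) (a : WittVector p R) (n : ℕ) :
    teichCoord (WittVector.teichmuller p x * a) n = x * teichCoord a n := by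
  rw [teichCoord_eq_iff]
  have h := (dvd_sub_sum_teichCoord a n).mul_left (WittVector.teichmuller p x)
  rw [mul_sub, Finset.mul_sum] at h
  simp only [← mul_assoc, ← map_mul] at h
  rw [dvd_sub_iff_coeff_eq] at h
  rw [h n le_rfl, coeff_sum_teichmuller _ n n le_rfl]

theorem teichCoord_p_mul_zero (a : WittVector p R) :
    teichCoord ((p : WittVector p R) * a) 0 = 0 := by
  rw [teichCoord_eq_iff, mul_comm]
  simpa using WittVector.mul_charP_coeff_zero a

theorem teichCoord_p_mul_succ (a : WittVector p R) (n : ℕ) :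
    teichCoord ((p : WittVector p R) * a) (n + 1) = teichCoord a n := by
  rw [teichCoord_eq_iff, mul_comm, WittVector.mul_charP_coeff_succ, ← teichCoord_pow a n,
    ← pow_mul, pow_succ]

/-- The Gauss norm `|∑ [x_n] p ^ n|_ρ = sup_n |x_n| ρ ^ n` on Witt vectors. -/
def gaussW (v : Valuation R ℝ≥0) (ρ : ℝ≥0) (a : WittVector p R) : ℝ≥0 :=
  ⨆ n : ℕ, v (teichCoord a n) * ρ ^ n

section

variable {v : Valuation R ℝ≥0} {ρ : ℝ≥0}

theorem gaussW_bdd (hv : ∀ x, v x ≤ 1) (hρ : ρ ≤ 1)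
    (a : WittVector p R) :
    BddAbove (Set.range fun n : ℕ => v (teichCoord a n) * ρ ^ n) := by
  refine ⟨1, ?_⟩
  rintro _ ⟨n, rfl⟩
  exact mul_le_one' (hv _) (pow_le_one₀ (zero_le) hρ)

theorem le_gaussW (hv : ∀ x, v x ≤ 1) (hρ : ρ ≤ 1)
    (a : WittVector p R) (n : ℕ) :
    v (teichCoord a n) * ρ ^ n ≤ gaussW v ρ a :=
  le_ciSup (gaussW_bdd hv hρ a) n

theorem gaussW_sub_le_of_le (hv : ∀ x, v x ≤ 1) (hρ : ρ ≤ 1)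
    (hρ0 : 0 < ρ) {a b : WittVector p R} {C : ℝ≥0}
    (ha : gaussW v ρ a ≤ C) (hb : gaussW v ρ b ≤ C) : gaussW v ρ (a - b) ≤ C := by
  refine ciSup_le fun n => ?_
  have key : ∀ c : WittVector p R, gaussW v ρ c ≤ C →
      ∀ i ≤ n, v (c.coeff i) ≤ (C / ρ ^ n) ^ p ^ i := by
    intro c hc i hi
    rw [← teichCoord_pow, map_pow]
    refine pow_le_pow_left' ?_ _
    rw [le_div_iff₀ (pow_pos hρ0 n)]
    refine le_trans ?_ ((le_gaussW hv hρ c i).trans hc)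
    exact mul_le_mul' le_rfl (pow_le_pow_of_le_one zero_le hρ hi)
  have h := valuation_coeff_sub_le v hv a b n (C / ρ ^ n) (key a ha) (key b hb)
  rw [← teichCoord_pow, map_pow] at h
  rw [← le_div_iff₀ (pow_pos hρ0 n)]
  exact (pow_le_pow_iff_left₀ (zero_le) (zero_le)
    (pow_ne_zero _ (Fact.out : p.Prime).ne_zero)).mp h

theorem gaussW_zero : gaussW v ρ (0 : WittVector p R) = 0 := by
  have h : ∀ n, teichCoord (0 : WittVector p R) n = 0 := fun n => by
    rw [teichCoord_eq_iff, WittVector.zero_coeff,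
      zero_pow (pow_ne_zero _ (Fact.out : p.Prime).ne_zero)]
  simp [gaussW, h]

theorem gaussW_neg (hv : ∀ x, v x ≤ 1) (hρ : ρ ≤ 1)
    (hρ0 : 0 < ρ) (a : WittVector p R) : gaussW v ρ (-a) = gaussW v ρ a := by
  have h : ∀ b : WittVector p R, gaussW v ρ (-b) ≤ gaussW v ρ b := fun b => by
    rw [← zero_sub]
    exact gaussW_sub_le_of_le hv hρ hρ0 (by rw [gaussW_zero]; exact zero_le) le_rfl
  refine le_antisymm (h a) ?_
  simpa using h (-a)

theorem gaussW_add_le_of_le (hv : ∀ x, v x ≤ 1) (hρ : ρ ≤ 1)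
    (hρ0 : 0 < ρ) {a b : WittVector p R} {C : ℝ≥0}
    (ha : gaussW v ρ a ≤ C) (hb : gaussW v ρ b ≤ C) : gaussW v ρ (a + b) ≤ C := by
  rw [← sub_neg_eq_add]
  exact gaussW_sub_le_of_le hv hρ hρ0 ha (by rwa [gaussW_neg hv hρ hρ0])

theorem gaussW_sum_le_of_le (hv : ∀ x, v x ≤ 1) (hρ : ρ ≤ 1)
    (hρ0 : 0 < ρ) {ι : Type*} (s : Finset ι) (f : ι → WittVector p R)
    {C : ℝ≥0} (h : ∀ i ∈ s, gaussW v ρ (f i) ≤ C) : gaussW v ρ (∑ i ∈ s, f i) ≤ C := by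
  classical
  induction s using Finset.induction_on with
  | empty => rw [Finset.sum_empty, gaussW_zero]; exact zero_le
  | insert a s ha ih =>
    rw [Finset.sum_insert ha]
    exact gaussW_add_le_of_le hv hρ hρ0 (h a (Finset.mem_insert_self a s))
      (ih fun i hi => h i (Finset.mem_insert_of_mem hi))

theorem gaussW_teichmuller_mul (x : R) (a : WittVector p R) :
    gaussW v ρ (WittVector.teichmuller p x * a) = v x * gaussW v ρ a := by
  rw [gaussW, gaussW, NNReal.mul_iSup]
  exact iSup_congr fun n => by rw [teichCoord_teichmuller_mul, map_mul, mul_assoc]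

theorem gaussW_p_mul (hv : ∀ x, v x ≤ 1) (hρ : ρ ≤ 1)
    (a : WittVector p R) :
    gaussW v ρ ((p : WittVector p R) * a) = ρ * gaussW v ρ a := by
  refine le_antisymm (ciSup_le fun n => ?_) ?_
  · cases n with
    | zero => rw [teichCoord_p_mul_zero, map_zero, zero_mul]; exact zero_le
    | succ n =>
      rw [teichCoord_p_mul_succ, pow_succ', mul_left_comm]
      exact mul_le_mul_right (le_gaussW hv hρ a n) ρ
  · rw [gaussW, gaussW, NNReal.mul_iSup]
    refine ciSup_le fun n => ?_
    have h := le_gaussW hv hρ ((p : WittVector p R) * a) (n + 1)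
    rw [teichCoord_p_mul_succ, pow_succ', mul_left_comm] at h
    exact h

theorem gaussW_teichmuller_mul_p_pow_mul (hv : ∀ x, v x ≤ 1) (hρ : ρ ≤ 1)
    (x : R) (k : ℕ) (a : WittVector p R) :
    gaussW v ρ (WittVector.teichmuller p x * (p : WittVector p R) ^ k * a)
      = v x * ρ ^ k * gaussW v ρ a := by
  rw [mul_assoc, gaussW_teichmuller_mul, mul_assoc]
  congr 1
  induction k with
  | zero => simp
  | succ k ih => rw [pow_succ', mul_assoc, gaussW_p_mul hv hρ, ih, pow_succ', mul_assoc]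

theorem gaussW_mul_le (hv : ∀ x, v x ≤ 1) (hρ : ρ ≤ 1)
    (hρ0 : 0 < ρ) (a b : WittVector p R) :
    gaussW v ρ (a * b) ≤ gaussW v ρ a * gaussW v ρ b := by
  refine ciSup_le fun n => ?_
  set s := ∑ i ∈ Finset.Iic n,
    WittVector.teichmuller p (teichCoord a i) * (p : WittVector p R) ^ i with hs
  have h := (dvd_sub_sum_teichCoord a n).mul_right b
  rw [sub_mul, dvd_sub_iff_coeff_eq] at h
  have hn : teichCoord (a * b) n = teichCoord (s * b) n := by
    rw [teichCoord_eq_iff, teichCoord_pow]; exact h n le_rfl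
  rw [hn]
  refine (le_gaussW hv hρ (s * b) n).trans ?_
  rw [hs, Finset.sum_mul]
  refine gaussW_sum_le_of_le hv hρ hρ0 _ _ fun i _ => ?_
  rw [gaussW_teichmuller_mul_p_pow_mul hv hρ]
  exact mul_le_mul_left (le_gaussW hv hρ a i) _

theorem teichCoord_frobenius (a : WittVector p R) (n : ℕ) :
    teichCoord (WittVector.frobenius a) n = teichCoord a n ^ p := by
  rw [teichCoord_eq_iff, WittVector.coeff_frobenius_charP, ← pow_mul, mul_comm, pow_mul,
    teichCoord_pow]

end

end GaussNormWitt

/-! ### The field `F`, the ring `W(𝒪_F)` and the ring `B` -/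

section RingB

variable (p : ℕ) [Fact p.Prime]

instance fact_not_isUnit_p : Fact (¬ IsUnit (p : 𝓞_ℂ_[p])) :=
  ⟨fun hu => by
    have h := (PadicComplexInt.integers p).one_of_isUnit hu
    rw [map_natCast, PadicComplex.valuation_p, one_div, inv_eq_one] at h
    exact (Fact.out : p.Prime).one_lt.ne' (by exact_mod_cast h)⟩

/-- The valuation ring `𝒪_F` of the tilt `F` of `ℂ_p`. -/
abbrev OF : Type := PreTilt 𝓞_ℂ_[p] p

/-- The absolute value of `F`, restricted to `𝒪_F`. It is normalised by `|x|_F = |x^♯|`, where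
`x^♯` is the image of `x` in `ℂ_p` and `|p| = 1 / p`. -/
def absF : Valuation (OF p) ℝ≥0 :=
  PreTilt.val ℂ_[p] (PadicComplex.valued p).v 𝓞_ℂ_[p] (PadicComplexInt.integers p) p

instance isDomain_OF : IsDomain (OF p) :=
  PreTilt.isDomain ℂ_[p] (PadicComplex.valued p).v 𝓞_ℂ_[p] (PadicComplexInt.integers p) p

theorem absF_eq_zero {x : OF p} : absF p x = 0 ↔ x = 0 :=
  PreTilt.map_eq_zero (PadicComplexInt.integers p)

theorem absF_le_one (x : OF p) : absF p x ≤ 1 := by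
  by_cases hx : x = 0
  · rw [hx, map_zero]; exact zero_le
  obtain ⟨n, hn⟩ : ∃ n, PreTilt.coeff n x ≠ 0 := not_forall.1 fun h => hx <| Perfection.ext h
  change PreTilt.valAux _ _ _ p x ≤ 1
  rw [PreTilt.valAux_eq (PadicComplexInt.integers p) hn]
  refine pow_le_one₀ zero_le ?_
  obtain ⟨y, hy⟩ := Ideal.Quotient.mk_surjective (PreTilt.coeff n x)
  rw [← hy] at hn ⊢
  rw [ModP.preVal_mk (PadicComplexInt.integers p) hn]
  exact (PadicComplexInt.integers p).map_le_one y

/-- The ring `W(𝒪_F)` of Witt vectors. -/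
abbrev Ainf : Type := WittVector p (OF p)

variable {p} in
/-- The Teichmüller representative `[x] ∈ W(𝒪_F)`. -/
abbrev teich (x : OF p) : Ainf p := WittVector.teichmuller p x

/-- The multiplicative set of all `[c] p ^ k`, `c ≠ 0`, in `W(𝒪_F)`. -/
def denominators : Submonoid (Ainf p) where
  carrier := {s | ∃ (c : OF p) (k : ℕ), c ≠ 0 ∧ s = teich c * (p : Ainf p) ^ k}
  one_mem' := ⟨1, 0, one_ne_zero, by simp⟩
  mul_mem' := by
    rintro _ _ ⟨c, k, hc, rfl⟩ ⟨d, m, hd, rfl⟩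
    exact ⟨c * d, k + m, mul_ne_zero hc hd, by
      rw [teich, teich, teich, map_mul, pow_add]; ring⟩

/-- The ring `B^b = W(𝒪_F)[1/p, 1/[ϖ]]`, where `ϖ` is any nonzero element of the maximal ideal
(inverting one such `[ϖ]` amounts to inverting all `[c]`, `c ≠ 0`). -/
abbrev Bb : Type := Localization (denominators p)

/-- The open interval `(0, 1)`. -/
abbrev Radius : Type := Set.Ioo (0 : ℝ) 1

variable {p}

/-- A radius `ρ ∈ (0, 1)` as a nonnegative real. -/
def Radius.toNN (ρ : Radius) : ℝ≥0 := ⟨ρ.1, ρ.2.1.le⟩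

theorem Radius.pos (ρ : Radius) : 0 < ρ.toNN := ρ.2.1
theorem Radius.le_one (ρ : Radius) : ρ.toNN ≤ 1 := ρ.2.2.le

theorem gaussW_denominators (ρ : Radius) (s : denominators p) :
    gaussW (absF p) ρ.toNN (s : Ainf p) ≠ 0 ∧ ∀ a, gaussW (absF p) ρ.toNN ((s : Ainf p) * a)
      = gaussW (absF p) ρ.toNN (s : Ainf p) * gaussW (absF p) ρ.toNN a := by
  obtain ⟨_, c, k, hc, rfl⟩ := s
  have hmul := gaussW_teichmuller_mul_p_pow_mul (absF_le_one p) ρ.le_one c k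
  have h1 : gaussW (absF p) ρ.toNN (1 : Ainf p) = 1 := by
    refine le_antisymm (ciSup_le fun n => mul_le_one' (absF_le_one p _)
      (pow_le_one₀ zero_le ρ.le_one)) ?_
    refine le_trans ?_ (le_gaussW (absF_le_one p) ρ.le_one (1 : Ainf p) 0)
    have : teichCoord (1 : Ainf p) 0 = 1 := by rw [teichCoord_eq_iff]; simp
    rw [this]; simp
  have hs : gaussW (absF p) ρ.toNN (teich c * (p : Ainf p) ^ k) = absF p c * ρ.toNN ^ k := by
    simpa [h1] using hmul 1
  refine ⟨?_, fun a => ?_⟩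
  · rw [hs]
    exact mul_ne_zero (fun h => hc ((absF_eq_zero p).mp h)) (pow_ne_zero _ ρ.pos.ne')
  · exact (hmul a).trans (by rw [hs])

/-- The Gauss norm `|·|_ρ` on `B^b`, given by `|a / s|_ρ = |a|_ρ / |s|_ρ`. -/
def gaussBb (ρ : Radius) (x : Bb p) : ℝ≥0 :=
  Localization.liftOn x
    (fun a s => gaussW (absF p) ρ.toNN a / gaussW (absF p) ρ.toNN (s : Ainf p)) (by
      intro a c b d h
      obtain ⟨t, ht⟩ := Localization.r_iff_exists.mp h
      have h2 := congrArg (gaussW (absF p) ρ.toNN) ht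
      rw [(gaussW_denominators ρ t).2, (gaussW_denominators ρ t).2,
        (gaussW_denominators ρ d).2, (gaussW_denominators ρ b).2] at h2
      have h3 := mul_left_cancel₀ (gaussW_denominators ρ t).1 h2
      rw [div_eq_div_iff (gaussW_denominators ρ b).1 (gaussW_denominators ρ d).1]
      rw [mul_comm, h3, mul_comm])

theorem gaussBb_mk (ρ : Radius) (a : Ainf p) (s : denominators p) :
    gaussBb ρ (Localization.mk a s)
      = gaussW (absF p) ρ.toNN a / gaussW (absF p) ρ.toNN (s : Ainf p) := rfl

/-- The Gauss norm `|·|_ρ` as a ring seminorm on `B^b`. -/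
def gaussSeminorm (ρ : Radius) : RingSeminorm (Bb p) where
  toFun x := gaussBb ρ x
  map_zero' := by
    rw [← Localization.mk_zero (1 : denominators p), gaussBb_mk, gaussW_zero, zero_div]; rfl
  add_le' x y := by
    induction x using Localization.induction_on with | _ x
    induction y using Localization.induction_on with | _ y
    obtain ⟨a, s⟩ := x
    obtain ⟨b, t⟩ := y
    have hs := gaussW_denominators ρ s
    have ht := gaussW_denominators ρ t
    rw [Localization.add_mk]
    norm_cast
    rw [gaussBb_mk, gaussBb_mk, gaussBb_mk, Submonoid.coe_mul, hs.2]
    refine le_trans ?_ (max_le_add_of_nonneg zero_le zero_le)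
    rw [div_le_iff₀ (pos_of_ne_zero (mul_ne_zero hs.1 ht.1))]
    refine gaussW_add_le_of_le (absF_le_one p) ρ.le_one ρ.pos ?_ ?_
    · rw [hs.2, ← div_le_iff₀ (pos_of_ne_zero (mul_ne_zero hs.1 ht.1)), 
        mul_div_mul_left _ _ hs.1]
      exact le_max_right _ _
    · rw [ht.2, ← div_le_iff₀ (pos_of_ne_zero (mul_ne_zero hs.1 ht.1)),
        mul_comm (gaussW (absF p) ρ.toNN (s : Ainf p)), mul_div_mul_left _ _ ht.1]
      exact le_max_left _ _
  neg' x := by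
    induction x using Localization.induction_on with | _ x
    rw [Localization.neg_mk, gaussBb_mk, gaussBb_mk,
      gaussW_neg (absF_le_one p) ρ.le_one ρ.pos]
  mul_le' x y := by
    induction x using Localization.induction_on with | _ x
    induction y using Localization.induction_on with | _ y
    rw [Localization.mk_mul]
    norm_cast
    rw [gaussBb_mk, gaussBb_mk, gaussBb_mk, Submonoid.coe_mul, (gaussW_denominators ρ x.2).2,
      div_mul_div_comm]
    exact div_le_div_of_nonneg_right (gaussW_mul_le (absF_le_one p) ρ.le_one ρ.pos _ _) zero_le

/-- The uniform structure on `B^b` defined by the norm `|·|_ρ`. -/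
abbrev uniformSpaceAt (ρ : Radius) : UniformSpace (Bb p) :=
  (gaussSeminorm ρ).toSeminormedRing.toPseudoMetricSpace.toUniformSpace

/-- The uniform structure on `B^b` defined by the family of norms `|·|_ρ`, `ρ ∈ (0, 1)`. -/
instance uniformSpaceBb : UniformSpace (Bb p) := ⨅ ρ : Radius, uniformSpaceAt ρ

instance isUniformAddGroup_Bb : IsUniformAddGroup (Bb p) :=
  isUniformAddGroup_iInf fun ρ =>
    letI := (gaussSeminorm (p := p) ρ).toSeminormedRing
    inferInstance

theorem topologicalSpaceBb_eq : (uniformSpaceBb (p := p)).toTopologicalSpace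
    = ⨅ ρ : Radius, (uniformSpaceAt (p := p) ρ).toTopologicalSpace := by
  rw [uniformSpaceBb, UniformSpace.toTopologicalSpace_iInf]

instance isTopologicalRing_Bb : IsTopologicalRing (Bb p) := by
  have h : ContinuousMul (Bb p) := by
    rw [topologicalSpaceBb_eq]
    exact continuousMul_iInf fun ρ =>
      letI := (gaussSeminorm (p := p) ρ).toSeminormedRing
      inferInstance
  exact { }

variable (p) in
/-- The Fargues–Fontaine ring `B`: the completion of `B^b` for the norms `|·|_ρ`, `ρ ∈ (0, 1)`. -/
abbrev B : Type := UniformSpace.Completion (Bb p)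

/-- The canonical map `W(𝒪_F) → B`. -/
def toB : Ainf p →+* B p :=
  (UniformSpace.Completion.coeRingHom (α := Bb p)).comp (algebraMap (Ainf p) (Bb p))

/-- The norm `|·|_ρ` on `B`, extending the Gauss norm of `B^b` by continuity. -/
def normB (ρ : Radius) : B p → ℝ := UniformSpace.Completion.extension (gaussSeminorm ρ)


theorem teichCoord_map (g : OF p →+* OF p) (a : Ainf p) (n : ℕ) :
    teichCoord (WittVector.map g a) n = g (teichCoord a n) := by
  rw [teichCoord_eq_iff, WittVector.map_coeff, ← map_pow, teichCoord_pow]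

/-- The radius `ρ ^ (1 / k)`. -/
def Radius.root (ρ : Radius) (k : ℕ) (hk : k ≠ 0) : Radius :=
  ⟨ρ.1 ^ (1 / k : ℝ), Real.rpow_pos_of_pos ρ.2.1 _,
    Real.rpow_lt_one ρ.2.1.le ρ.2.2 (by positivity)⟩

theorem Radius.root_pow (ρ : Radius) (k : ℕ) (hk : k ≠ 0) : (ρ.root k hk).toNN ^ k = ρ.toNN := by
  ext
  change (ρ.1 ^ (1 / k : ℝ)) ^ k = ρ.1
  rw [one_div, Real.rpow_inv_natCast_pow ρ.2.1.le hk]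

theorem gaussW_map (g : OF p →+* OF p) (k : ℕ) (hk : k ≠ 0)
    (hg : ∀ x, absF p (g x) = absF p x ^ k) (ρ : Radius) (a : Ainf p) :
    gaussW (absF p) ρ.toNN (WittVector.map g a)
      = gaussW (absF p) (ρ.root k hk).toNN a ^ k := by
  have h : ∀ n, absF p (teichCoord (WittVector.map g a) n) * ρ.toNN ^ n
      = (absF p (teichCoord a n) * (ρ.root k hk).toNN ^ n) ^ k := fun n => by
    rw [teichCoord_map, hg, mul_pow, ← pow_mul, mul_comm n k, pow_mul, Radius.root_pow]
  rw [gaussW, gaussW, NNReal.iSup_pow]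
  exact iSup_congr h

theorem continuous_ringHom_of_norm_le {R S : Type*} [SeminormedRing R] [SeminormedRing S]
    (f : R →+* S) (k : ℕ) (hk : k ≠ 0) (h : ∀ x, ‖f x‖ ≤ ‖x‖ ^ k) : Continuous f := by
  refine continuous_of_continuousAt_zero f ?_
  rw [ContinuousAt, map_zero]
  refine squeeze_zero_norm h ?_
  have h0 : Filter.Tendsto (fun x : R => ‖x‖ ^ k) (nhds 0) (nhds (‖(0 : R)‖ ^ k)) :=
    (continuous_norm.pow k).tendsto 0
  rwa [norm_zero, zero_pow hk] at h0

theorem continuous_of_norm_le (f : Bb p →+* Bb p)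
    (h : ∀ ρ : Radius, ∃ (ρ' : Radius) (k : ℕ), k ≠ 0 ∧ ∀ x, gaussBb ρ (f x) ≤ gaussBb ρ' x ^ k) :
    Continuous f := by
  have hc : @Continuous _ _ (⨅ ρ : Radius, (uniformSpaceAt (p := p) ρ).toTopologicalSpace)
      (⨅ ρ : Radius, (uniformSpaceAt (p := p) ρ).toTopologicalSpace) f := by
    rw [continuous_iInf_rng]
    intro ρ
    obtain ⟨ρ', k, hk, hx⟩ := h ρ
    refine continuous_iInf_dom (i := ρ') ?_
    exact @continuous_ringHom_of_norm_le (Bb p) (Bb p) (gaussSeminorm ρ').toSeminormedRing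
      (gaussSeminorm ρ).toSeminormedRing f k hk fun x => by exact_mod_cast hx x
  rwa [← topologicalSpaceBb_eq] at hc

/-- A ring endomorphism of `𝒪_F` that raises absolute values to a fixed power `k ≥ 1`. -/
def ScalesAbs (g : OF p →+* OF p) : Prop :=
  ∃ k : ℕ, k ≠ 0 ∧ ∀ x, absF p (g x) = absF p x ^ k

theorem ScalesAbs.map_mem {g : OF p →+* OF p} (hg : ScalesAbs g) (s : denominators p) :
    WittVector.map g (s : Ainf p) ∈ denominators p := by
  obtain ⟨_, c, k, hc, rfl⟩ := s
  obtain ⟨m, -, hm⟩ := hg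
  refine ⟨g c, k, fun h => hc ?_, ?_⟩
  · have h1 := hm c
    rw [h, map_zero] at h1
    exact (absF_eq_zero p).mp (eq_zero_of_pow_eq_zero h1.symm)
  · rw [map_mul, map_pow, map_natCast, WittVector.map_teichmuller]

/-- The endomorphism of `B^b` induced by an endomorphism of `𝒪_F`. -/
def mapBb (g : OF p →+* OF p) (hg : ScalesAbs g) : Bb p →+* Bb p :=
  IsLocalization.map (Bb p) (WittVector.map g)
    (show denominators p ≤ (denominators p).comap _ from fun s hs => hg.map_mem ⟨s, hs⟩)

theorem continuous_mapBb (g : OF p →+* OF p) (hg : ScalesAbs g) : Continuous (mapBb g hg) := by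
  refine continuous_of_norm_le _ fun ρ => ?_
  obtain ⟨k, hk, hm⟩ := id hg
  refine ⟨ρ.root k hk, k, hk, fun x => ?_⟩
  induction x using Localization.induction_on with | _ x
  obtain ⟨a, s⟩ := x
  have h : mapBb g hg (Localization.mk a s)
      = Localization.mk (WittVector.map g a) ⟨WittVector.map g s, hg.map_mem s⟩ := by
    rw [Localization.mk_eq_mk']
    exact IsLocalization.map_mk' _ _ _
  rw [h, gaussBb_mk, gaussBb_mk, gaussW_map g k hk hm, div_pow]
  refine le_of_eq ?_
  congr 1
  exact gaussW_map g k hk hm ρ (s : Ainf p)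

/-- The continuous endomorphism of `B` induced by an endomorphism of `𝒪_F`. -/
def mapB (g : OF p →+* OF p) (hg : ScalesAbs g) : B p →+* B p :=
  UniformSpace.Completion.mapRingHom (mapBb g hg) (continuous_mapBb g hg)

theorem scalesAbs_frobenius : ScalesAbs (frobenius (OF p) p) :=
  ⟨p, (Fact.out : p.Prime).ne_zero, fun x => by rw [frobenius_def, map_pow]⟩

variable (p) in
/-- The Frobenius `φ` of `B`. On `W(𝒪_F)` it is the Witt vector Frobenius, that is, the map
induced by `x ↦ x ^ p`. -/
def phi : B p →+* B p := mapB (frobenius (OF p) p) scalesAbs_frobenius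

variable (p) in
/-- The topological group `B^{φ = p} = {b ∈ B | φ(b) = p b}`; it is the image of the points
`𝒢(𝒪_F)` of the Lubin–Tate formal group under the logarithm. -/
def eigenspace : AddSubgroup (B p) where
  carrier := {b | phi p b = (p : B p) * b}
  zero_mem' := by simp
  add_mem' := by
    intro a b ha hb
    rw [Set.mem_ofPred_eq] at ha hb ⊢
    rw [map_add, ha, hb, mul_add]
  neg_mem' := by
    intro a ha
    rw [Set.mem_ofPred_eq] at ha ⊢
    rw [map_neg, ha, mul_neg]

/-! ### The Galois action -/

theorem norm_gal (σ : PadicAlgCl p ≃ₐ[ℚ_[p]] PadicAlgCl p) (x : PadicAlgCl p) : ‖σ x‖ = ‖x‖ :=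
  (spectralNorm_eq_of_equiv σ x).symm

theorem isometry_gal (σ : PadicAlgCl p ≃ₐ[ℚ_[p]] PadicAlgCl p) :
    Isometry (σ : PadicAlgCl p →+* PadicAlgCl p) :=
  AddMonoidHomClass.isometry_of_norm _ (norm_gal σ)

/-- An automorphism of `ℚ̄_p` over `ℚ_p`, extended to `ℂ_p` by continuity. -/
def galCp (σ : PadicAlgCl p ≃ₐ[ℚ_[p]] PadicAlgCl p) : ℂ_[p] →+* ℂ_[p] :=
  UniformSpace.Completion.mapRingHom (σ : PadicAlgCl p →+* PadicAlgCl p)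
    (isometry_gal σ).continuous

theorem norm_galCp (σ : PadicAlgCl p ≃ₐ[ℚ_[p]] PadicAlgCl p) (x : ℂ_[p]) :
    ‖galCp σ x‖ = ‖x‖ :=
  AddMonoidHomClass.isometry_iff_norm (galCp σ) |>.mp
    ((isometry_gal σ).completion_map) x

theorem val_eq_norm (x : ℂ_[p]) : ((PadicComplex.valued p).v x : ℝ) = ‖x‖ := by
  rw [PadicComplex.norm_eq_norm, Valuation.norm_def, PadicComplex.RankOne.hom_eq_embedding,
    Valuation.embedding_restrict]

theorem val_galCp (σ : PadicAlgCl p ≃ₐ[ℚ_[p]] PadicAlgCl p) (x : ℂ_[p]) :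
    (PadicComplex.valued p).v (galCp σ x) = (PadicComplex.valued p).v x := by
  ext
  rw [val_eq_norm, val_eq_norm, norm_galCp]

/-- The Galois action on `𝒪_{ℂ_p}`. -/
def galInt (σ : PadicAlgCl p ≃ₐ[ℚ_[p]] PadicAlgCl p) : 𝓞_ℂ_[p] →+* 𝓞_ℂ_[p] :=
  RingHom.restrict (galCp σ) (PadicComplexInt p) (PadicComplexInt p) fun x hx => by
    change (PadicComplex.valued p).v (galCp σ x) ≤ 1
    rw [val_galCp]
    exact hx

/-- The Galois action on `𝒪_{ℂ_p} / p`. -/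
def galModP (σ : PadicAlgCl p ≃ₐ[ℚ_[p]] PadicAlgCl p) :
    ModP 𝓞_ℂ_[p] p →+* ModP 𝓞_ℂ_[p] p :=
  Ideal.quotientMap _ (galInt σ) (by
    rw [Ideal.span_le, Set.singleton_subset_iff]
    change galInt σ (p : 𝓞_ℂ_[p]) ∈ Ideal.span {(p : 𝓞_ℂ_[p])}
    rw [map_natCast]
    exact Ideal.mem_span_singleton_self _)

/-- The Galois action on `𝒪_F`. -/
def galOF (σ : PadicAlgCl p ≃ₐ[ℚ_[p]] PadicAlgCl p) : OF p →+* OF p :=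
  Perfection.map p (galModP σ)

theorem preVal_galModP (σ : PadicAlgCl p ≃ₐ[ℚ_[p]] PadicAlgCl p) (x : ModP 𝓞_ℂ_[p] p)
    (hx : x ≠ 0) : galModP σ x ≠ 0 ∧
      ModP.preVal ℂ_[p] (PadicComplex.valued p).v 𝓞_ℂ_[p] p (galModP σ x)
        = ModP.preVal ℂ_[p] (PadicComplex.valued p).v 𝓞_ℂ_[p] p x := by
  obtain ⟨y, rfl⟩ := Ideal.Quotient.mk_surjective x
  have hv : (PadicComplex.valued p).v (algebraMap 𝓞_ℂ_[p] ℂ_[p] (galInt σ y))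
      = (PadicComplex.valued p).v (algebraMap 𝓞_ℂ_[p] ℂ_[p] y) := val_galCp σ y
  have h : galModP σ (Ideal.Quotient.mk _ y) = Ideal.Quotient.mk _ (galInt σ y) := rfl
  have h0 : (Ideal.Quotient.mk _ (galInt σ y) : ModP 𝓞_ℂ_[p] p) ≠ 0 := by
    rw [← ModP.v_p_lt_val (PadicComplexInt.integers p)] at hx ⊢
    rwa [hv]
  rw [h]
  refine ⟨h0, ?_⟩
  rw [ModP.preVal_mk (PadicComplexInt.integers p) h0,
    ModP.preVal_mk (PadicComplexInt.integers p) hx, hv]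

theorem absF_galOF (σ : PadicAlgCl p ≃ₐ[ℚ_[p]] PadicAlgCl p) (x : OF p) :
    absF p (galOF σ x) = absF p x := by
  by_cases hx : x = 0
  · rw [hx, map_zero]
  obtain ⟨n, hn⟩ : ∃ n, PreTilt.coeff n x ≠ 0 := not_forall.1 fun h => hx <| Perfection.ext h
  have h : PreTilt.coeff n (galOF σ x) = galModP σ (PreTilt.coeff n x) := rfl
  obtain ⟨h0, h1⟩ := preVal_galModP σ _ hn
  change PreTilt.valAux _ _ _ p _ = PreTilt.valAux _ _ _ p _
  rw [PreTilt.valAux_eq (PadicComplexInt.integers p) hn,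
    PreTilt.valAux_eq (PadicComplexInt.integers p) (n := n) (by rw [h]; exact h0), h, h1]

theorem scalesAbs_galOF (σ : PadicAlgCl p ≃ₐ[ℚ_[p]] PadicAlgCl p) : ScalesAbs (galOF σ) :=
  ⟨1, one_ne_zero, fun x => by rw [absF_galOF, pow_one]⟩

/-- The Galois action on `B`. -/
def galB (σ : PadicAlgCl p ≃ₐ[ℚ_[p]] PadicAlgCl p) : B p →+* B p :=
  mapB (galOF σ) (scalesAbs_galOF σ)


/-! ### Points of degree one and their Tate modules -/

variable (p) in
/-- A closed point of degree one, given by its ideal `℘` of `W(𝒪_F)`. Since `F` is algebraically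
closed, every ideal generated by a primitive element of degree one is of the form `([a] - p)`
with `0 < |a|_F < 1`. -/
structure Point where
  /-- The ideal `℘` of `W(𝒪_F)`. -/
  ideal : Ideal (Ainf p)
  exists_eq_span : ∃ a : OF p, a ≠ 0 ∧ absF p a < 1 ∧ ideal = Ideal.span {teich a - (p : Ainf p)}

/-- The valuation ring `𝒪_K = W(𝒪_F) / ℘` of the residue field `K` of a point. -/
abbrev Point.integers (y : Point p) : Type := Ainf p ⧸ y.ideal

/-- The residue field `K` of a point, the fraction field of the domain `W(𝒪_F) / ℘`. -/
abbrev Point.residueField (y : Point p) : Type := FractionRing y.integers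

/-- The surjection `η_K : W(𝒪_F) → 𝒪_K`, composed with the inclusion `𝒪_K → K`. -/
def Point.eta (y : Point p) : Ainf p →+* y.residueField :=
  (algebraMap y.integers y.residueField).comp (Ideal.Quotient.mk y.ideal)

/-- The element `log [u] = ∑_{n ≥ 1} (-1)^(n+1) ([u] - 1)^n / n` of `B`, for `|u - 1|_F < 1`. -/
def logTeich (u : OF p) : B p :=
  ∑' n : ℕ, (-1) ^ n * Ring.inverse ((n + 1 : ℕ) : B p) * (toB (teich u) - 1) ^ (n + 1)

/-- The Tate module `T_y ⊆ B^{φ = p}` of the point `y`. Under the identification of the formal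
group `𝒢` with the formal multiplicative group, `B^{φ = p}` consists of the `log [u]` with
`u ∈ 1 + 𝔪_F`, and `T_y` of those with `η_K([u]) = 1`, that is, of the compatible systems
of `p`-power roots of unity `η_K([u ^ (1 / p ^ n)])` of `K`. -/
def Point.tateModule (y : Point p) : Set (B p) :=
  {t | ∃ u : OF p, absF p (u - 1) < 1 ∧ y.eta (teich u) = 1 ∧ t = logTeich u}

variable (p) in
/-- The set `Σ_F` of tuples of points `([a] - p, [a ^ (2 ^ 2)] - p, …, [a ^ (n ^ 2)] - p)` with
`0 < |a|_F < 1`. -/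
def SigmaF (n : ℕ) : Set (Fin n → Point p) :=
  {y | ∃ a : OF p, a ≠ 0 ∧ absF p a < 1 ∧
    ∀ j : Fin n, (y j).ideal = Ideal.span {teich (a ^ ((j : ℕ) + 1) ^ 2) - (p : Ainf p)}}

/-! ### The action of `Aut(G_E ↷ 𝒢(𝒪_F))` on points -/

/-- A topological automorphism `f` of `B^{φ = p} = 𝒢(𝒪_F)` belongs to `Aut(G_E ↷ 𝒢(𝒪_F))` if
it is compatible with the action of `G_E`, up to an automorphism `α` of the topological
group `G_E`: one has `f(σ v) = α(σ) f(v)`. -/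
def IsAutOfGaloisModule (E : IntermediateField ℚ_[p] (PadicAlgCl p))
    (f : eigenspace p ≃ₜ+ eigenspace p) : Prop :=
  ∃ α : E.fixingSubgroup ≃ₜ* E.fixingSubgroup, ∀ (σ : E.fixingSubgroup) (v w : eigenspace p),
    (w : B p) = galB σ.1 (v : B p) → (f w : B p) = galB (α σ).1 (f v : B p)

/-- `f` maps the point `y` to the point `y'`. A point `y` is identified with the class modulo
`ℤ_p^*` of a generator of the `ℤ_p`-line `T_y` of `𝒢(𝒪_F) = B^{φ = p}`; so this means that
`f(T_y) = T_y'`. -/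
def MapsPoint (f : eigenspace p ≃ₜ+ eigenspace p) (y y' : Point p) : Prop :=
  (fun v : eigenspace p => (f v : B p)) '' {v | (v : B p) ∈ y.tateModule} = y'.tateModule

/-! ### Lifts and the set `Θ̃` -/

/-- An embedding of valued fields of `E` into the residue field `K` of a point: a ring homomorphism
for which the valuation ring of `E` is the inverse image of the one of `K`. -/
structure Embedding (E : IntermediateField ℚ_[p] (PadicAlgCl p)) (y : Point p) where
  /-- The underlying ring homomorphism. -/
  toRingHom : E →+* y.residueField
  norm_le_one_iff : ∀ x : E, ‖(x : PadicAlgCl p)‖ ≤ 1 ↔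
    toRingHom x ∈ (algebraMap y.integers y.residueField).range

/-- `[x]` is a Teichmüller lift of `ξ ∈ E ⊆ K`, that is, `η_K([x]) = ξ`. -/
def IsTeichLift {E : IntermediateField ℚ_[p] (PadicAlgCl p)} {y : Point p} (ι : Embedding E y)
    (ξ : E) (x : OF p) : Prop :=
  y.eta (teich x) = ι.toRingHom ξ

section

variable {E : IntermediateField ℚ_[p] (PadicAlgCl p)} {n : ℕ}

/-- The lifts `([x_j] + τ_j)_j` of `ξ` over a tuple of points `y`: `[x_j]` is a Teichmüller lift of
`ξ ∈ K_j` and `τ_j` lies in `T_(y_j)`. -/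
def lifts (ι : ∀ y : Point p, Embedding E y) (ξ : E) (y : Fin n → Point p) : Set (Fin n → B p) :=
  {z | ∃ (x : Fin n → OF p) (τ : Fin n → B p), (∀ j, IsTeichLift (ι (y j)) ξ (x j)) ∧
    (∀ j, τ j ∈ (y j).tateModule) ∧ z = fun j => toB (teich (x j)) + τ j}

variable (E) in
/-- Stability of a subset of `B^n` under the diagonal action of `G_E`. -/
def IsGaloisStable (S : Set (Fin n → B p)) : Prop :=
  ∀ σ ∈ E.fixingSubgroup, ∀ z ∈ S, (fun j => galB σ (z j)) ∈ S

/-- Stability of a subset of `B^n` under `Aut(G_E ↷ 𝒢(𝒪_F))`. An element `f` of this group moves a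
tuple of points `y` to a tuple of points `y'`, and moves a lift `([x_j] + τ_j)_j` of `ξ` over `y`
to the lifts `([x'_j] + f(τ_j))_j` of `ξ` over `y'`. -/
def IsAutStable (ι : ∀ y : Point p, Embedding E y) (ξ : E) (S : Set (Fin n → B p)) : Prop :=
  ∀ f : eigenspace p ≃ₜ+ eigenspace p, IsAutOfGaloisModule E f →
  ∀ y y' : Fin n → Point p, (∀ j, MapsPoint f (y j) (y' j)) →
  ∀ (x x' : Fin n → OF p) (τ : Fin n → eigenspace p),
    (∀ j, ∃ ε : Embedding E (y j), IsTeichLift ε ξ (x j)) →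
    (∀ j, (τ j : B p) ∈ (y j).tateModule) →
    (fun j => toB (teich (x j)) + (τ j : B p)) ∈ S →
    (∀ j, IsTeichLift (ι (y' j)) ξ (x' j)) →
    (fun j => toB (teich (x' j)) + (f (τ j) : B p)) ∈ S

/-- The set `Θ̃ ⊆ B^n`: the smallest subset that contains all lifts of `ξ` over the points of `Σ_F`
and is stable under `G_E` and under `Aut(G_E ↷ 𝒢(𝒪_F))`. -/
def thetaTilde (n : ℕ) (ι : ∀ y : Point p, Embedding E y) (ξ : E) : Set (Fin n → B p) :=
  ⋂₀ {S | (∀ y ∈ SigmaF p n, lifts ι ξ y ⊆ S) ∧ IsGaloisStable E S ∧ IsAutStable ι ξ S}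

end

/-- The size `|S|_B = sup_ρ sup_{z ∈ S} ∏_j |z_j|_ρ ∈ [0, ∞]` of a subset `S` of `B^n`. -/
def sizeB {n : ℕ} (S : Set (Fin n → B p)) : ENNReal :=
  ⨆ ρ : Radius, ⨆ z ∈ S, ENNReal.ofReal (∏ j, normB ρ (z j))

end RingB

/-! ### Tate curves and theta values -/

section Tate

variable {K : Type*} [Field K] [TopologicalSpace K]

/-- The Tate curve `y² + xy = x³ + a₄ x + a₆` with `a₄ = -5 s₃`, `a₆ = -(5 s₃ + 7 s₅) / 12`, where
`s_k = ∑_{n ≥ 1} n ^ k q ^ n / (1 - q ^ n)`. -/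
def tateCurve (q : K) : WeierstrassCurve K :=
  let s : ℕ → K := fun k => ∑' n : ℕ, (n + 1 : K) ^ k * q ^ (n + 1) / (1 - q ^ (n + 1))
  { a₁ := 1, a₂ := 0, a₃ := 0, a₄ := -5 * s 3, a₆ := -(5 * s 3 + 7 * s 5) / 12 }

/-- The theta function `ϑ(u) = q^(-1/8) ∑_{n ∈ ℤ} (-1)^n q^((n + 1/2)² / 2) u^(2n+1)`, in which the
fractional powers of `q` combine to `q^(n(n+1)/2)`. -/
def thetaM (q u : K) : K :=
  ∑' n : ℤ, (-1) ^ n * q ^ (n * (n + 1) / 2) * u ^ (2 * n + 1)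

/-- The theta value `ξ₁` for the root `Q = q^(1/2ℓ)` of `q` and the primitive `ℓ`-th root of unity
`ζ`: its inverse is the ratio `ϑ(Q ζ) / ϑ(ζ)`, or its explicit form `-Q⁻¹ ζ⁻²` (the two expressions
agree for a theta function with `q` replaced by `Q²`; for `ϑ` itself they differ by a unit). -/
def IsThetaValue (q Q ζ ξ : K) : Prop :=
  ξ⁻¹ = thetaM q (Q * ζ) / thetaM q ζ ∨ ξ⁻¹ = -(Q⁻¹ * ζ⁻¹ ^ 2)

end Tate

/-- `q` is the Tate parameter of the elliptic curve `C` over the `p`-adic field `E`: one has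
`0 < |q| < 1`, and `C` is isomorphic over `E` to the Tate curve of `q`. -/
def IsTateParameter {p : ℕ} [Fact p.Prime] {E : IntermediateField ℚ_[p] (PadicAlgCl p)}
    (C : WeierstrassCurve E) (q : E) : Prop :=
  q ≠ 0 ∧ ‖(q : PadicAlgCl p)‖ < 1 ∧ ∃ u : WeierstrassCurve.VariableChange E, u • C = tateCurve q

end

end FarguesFontaine

open scoped NNReal

namespace FarguesFontaine
noncomputable section

/-! ### The ring of integers of `ℂ_[p]`: completeness and `p`-th roots modulo `p` -/

section IntegersOfCp

variable (p : ℕ) [Fact p.Prime]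

/-! The set `Σ_F` contains tuples with `|a|_F` as close to `1` as one likes, and the lifts over
these alone show that the size is at least every `t < 1`. At the point `([a] - p)` the element `p`
of the residue field is the image of `[a]`. If `ξ` divides `p ^ k` in the valuation ring, a
Teichmüller lift `x` of `ξ` therefore satisfies `|x|_F ≥ |a|_F ^ k`. The exponent `k` depends only
on `ξ`, since the embeddings of `E` respect valuation rings. With `τ = 0` and `|[x]|_ρ = |x|_F` for
every `ρ`, the tuple over `a` contributes at least `|a|_F ^ N` with `N = ∑ j ^ 2 * k`, and this
tends to `1` as `|a|_F → 1`. The right-hand side `|Q| ^ ℓ*` is less than `1`, so it is exceeded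
(`le_sizeB_thetaTilde`).

About the theta value only `ξ ≠ 0` and `|ξ| ≤ 1` are needed. Reading off the dominant terms of the
theta series gives `|ξ| = |Q|` in both normalizations (`norm_thetaValue_le_one`).

The main work is the existence of Teichmüller lifts (`exists_teich_eq_of_dvd`), that is, of
compatible systems of `p`-power roots in `O = W(𝒪_F) / ([a] - p)`. It rests on `O / p = 𝒪_F / a`.
Monic polynomials over `𝒪_F` have roots modulo any nonzero element, because `ℂ_p` is algebraically
closed. Hence monic polynomials over `O` have roots modulo `p`. This yields approximate `p`-th roots
of units, which are then refined by Newton iteration in the `p`-adically complete ring `O`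
(`exists_pth_root`). Dividing out powers of `p` reduces a divisor of `p ^ k` to the case of units.
-/

theorem mem_integers_iff_norm_le_one (x : ℂ_[p]) : x ∈ 𝓞_ℂ_[p] ↔ ‖x‖ ≤ 1 := by
  rw [← val_eq_norm]
  exact Iff.rfl

theorem natCast_p_pow_dvd_iff (x : 𝓞_ℂ_[p]) (n : ℕ) :
    (p : 𝓞_ℂ_[p]) ^ n ∣ x ↔ ‖(x : ℂ_[p])‖ ≤ (p : ℝ)⁻¹ ^ n := by
  rw [← (PadicComplexInt.integers p).le_iff_dvd, map_pow, map_natCast, ← NNReal.coe_le_coe,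
    map_pow, PadicComplex.valuation_p, ← val_eq_norm]
  simp

instance isAdicComplete_integersCp : IsAdicComplete (Ideal.span {(p : 𝓞_ℂ_[p])}) 𝓞_ℂ_[p] where
  haus' x h := by
    simp only [Ideal.span_singleton_pow, smul_eq_mul, Ideal.mul_top, SModEq.zero,
      Ideal.mem_span_singleton, natCast_p_pow_dvd_iff] at h
    have hp : (1 : ℝ) < p := by exact_mod_cast (Fact.out : p.Prime).one_lt
    have h0 : ‖(x : ℂ_[p])‖ ≤ 0 :=
      ge_of_tendsto' (tendsto_pow_atTop_nhds_zero_of_lt_one (by positivity)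
        (inv_lt_one_of_one_lt₀ hp)) h
    exact Subtype.ext (norm_le_zero_iff.mp h0)
  prec' f h := by
    simp only [Ideal.span_singleton_pow, smul_eq_mul, Ideal.mul_top, SModEq.sub_mem,
      Ideal.mem_span_singleton, natCast_p_pow_dvd_iff] at h ⊢
    have hp : (1 : ℝ) < p := by exact_mod_cast (Fact.out : p.Prime).one_lt
    have ht := tendsto_pow_atTop_nhds_zero_of_lt_one (by positivity) (inv_lt_one_of_one_lt₀ hp)
    have hd : ∀ m n, m ≤ n → dist (f m : ℂ_[p]) (f n) ≤ (p : ℝ)⁻¹ ^ m := fun m n hmn => by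
      rw [dist_eq_norm]; exact h hmn
    have hc : CauchySeq fun n => (f n : ℂ_[p]) :=
      cauchySeq_of_le_tendsto_0' _ hd ht
    obtain ⟨L, hL⟩ := cauchySeq_tendsto_of_complete hc
    have hLn : ∀ n, ‖(f n : ℂ_[p]) - L‖ ≤ (p : ℝ)⁻¹ ^ n := fun n => by
      rw [← dist_eq_norm]
      exact le_of_tendsto (tendsto_const_nhds.dist hL)
        (Filter.eventually_atTop.mpr ⟨n, fun m hm => hd n m hm⟩)
    have hmem : L ∈ 𝓞_ℂ_[p] := by
      have h1 := (mem_integers_iff_norm_le_one p _).mpr ((hLn 0).trans (by simp))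
      have := sub_mem (f 0).2 h1
      rwa [sub_sub_cancel] at this
    exact ⟨⟨L, hmem⟩, hLn⟩

theorem frobenius_ModP_surjective :
    Function.Surjective (frobenius (ModP 𝓞_ℂ_[p] p) p) := by
  intro x
  obtain ⟨y, rfl⟩ := Ideal.Quotient.mk_surjective x
  obtain ⟨z, hz⟩ := IsAlgClosed.exists_pow_nat_eq (y : ℂ_[p]) (Fact.out : p.Prime).pos
  have hz1 : z ∈ 𝓞_ℂ_[p] := by
    rw [mem_integers_iff_norm_le_one, ← pow_le_one_iff_of_nonneg (norm_nonneg _)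
      (Fact.out : p.Prime).ne_zero, ← norm_pow, hz, ← mem_integers_iff_norm_le_one]
    exact y.2
  refine ⟨Ideal.Quotient.mk _ ⟨z, hz1⟩, ?_⟩
  rw [frobenius_def, ← map_pow]
  congr 1
  exact Subtype.ext hz

theorem coeff_zero_surjective : Function.Surjective (PreTilt.coeff 0 : OF p → ModP 𝓞_ℂ_[p] p) :=
  Perfection.coeff_surjective (frobenius_ModP_surjective p) 0

end IntegersOfCp

/-! ### The valuation ring `𝒪_F`: divisibility, completeness, value group, roots of polynomials -/

section TiltValuation

variable {p : ℕ} [Fact p.Prime]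

theorem absF_eq_of_coeff_ne_zero {x : OF p} {n : ℕ} (h : PreTilt.coeff n x ≠ 0) :
    absF p x = ModP.preVal ℂ_[p] (PadicComplex.valued p).v 𝓞_ℂ_[p] p (PreTilt.coeff n x) ^ p ^ n :=
  PreTilt.valAux_eq (PadicComplexInt.integers p) h

theorem lt_absF_of_coeff_ne_zero {x : OF p} {n : ℕ} (h : PreTilt.coeff n x ≠ 0) :
    (p : ℝ≥0)⁻¹ ^ p ^ n < absF p x := by
  rw [absF_eq_of_coeff_ne_zero h]
  have := (ModP.v_p_lt_preVal (PadicComplexInt.integers p)).mpr h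
  rw [PadicComplex.valuation_p, one_div] at this
  exact pow_lt_pow_left₀ this zero_le (pow_ne_zero _ (Fact.out : p.Prime).ne_zero)

/-- Together with `lt_absF_of_coeff_ne_zero` this identifies the kernel of the `n`-th coefficient
map with a ball. If the coefficient at `m` vanishes and the next one, with lift `y`, does not, then
`p` divides `y ^ p`, which bounds `|y|` and hence `|x| = |y| ^ p ^ (m + 1)`. -/
theorem absF_le_of_coeff_eq_zero {x : OF p} {n : ℕ} (h : PreTilt.coeff n x = 0) :
    absF p x ≤ (p : ℝ≥0)⁻¹ ^ p ^ n := by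
  by_cases hx : x = 0
  · simp [hx]
  obtain ⟨m, hm⟩ : ∃ n, PreTilt.coeff n x ≠ 0 := not_forall.1 fun h => hx <| Perfection.ext h
  have hnm : n ≤ m := by
    by_contra hlt
    exact Perfection.coeff_ne_zero_of_le hm (not_le.mp hlt).le h
  obtain ⟨k, rfl⟩ := Nat.exists_eq_add_of_le hnm
  clear hnm
  induction k with
  | zero => exact absurd h hm
  | succ k ih =>
    by_cases hk : PreTilt.coeff (n + k) x = 0
    · rw [absF_eq_of_coeff_ne_zero hm]
      obtain ⟨y, hy⟩ := Ideal.Quotient.mk_surjective (PreTilt.coeff (n + (k + 1)) x)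
      have h1 : (Ideal.Quotient.mk _ (y ^ p) : ModP 𝓞_ℂ_[p] p) = 0 := by
        rw [map_pow, hy, ← hk]
        exact PreTilt.coeff_pow_p x (n + k)
      have h2 : ¬ (PadicComplex.valued p).v (p : ℂ_[p]) <
          (PadicComplex.valued p).v (algebraMap 𝓞_ℂ_[p] ℂ_[p] (y ^ p)) := fun h =>
        (ModP.v_p_lt_val (PadicComplexInt.integers p)).mp h h1
      rw [not_lt, PadicComplex.valuation_p, one_div, map_pow, map_pow] at h2
      rw [← hy] at hm
      rw [← hy, ModP.preVal_mk (PadicComplexInt.integers p) hm]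
      rw [← add_assoc, pow_succ' p, pow_mul]
      refine (pow_le_pow_left' h2 _).trans ?_
      exact pow_le_pow_of_le_one zero_le
        (inv_le_one_of_one_le₀ (by exact_mod_cast (Fact.out : p.Prime).one_lt.le))
        (Nat.pow_le_pow_right (Fact.out : p.Prime).pos (Nat.le_add_right n k))
    · exact ih hk

theorem coeff_eq_zero_of_absF_le {x : OF p} {n : ℕ} (h : absF p x ≤ (p : ℝ≥0)⁻¹ ^ p ^ n) :
    PreTilt.coeff n x = 0 := by
  by_contra hx
  exact (lt_absF_of_coeff_ne_zero hx).not_ge h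

theorem coeff_iterate_frobeniusEquiv_symm_zero (x : OF p) (n : ℕ) :
    PreTilt.coeff 0 ((frobeniusEquiv (OF p) p).symm^[n] x) = PreTilt.coeff n x := by
  simp [PreTilt.coeff_iterate_frobeniusEquiv_symm]

theorem val_untilt (x : OF p) :
    (PadicComplex.valued p).v (x.untilt : ℂ_[p]) = absF p x := by
  by_cases hx : x = 0
  · subst hx
    -- Multiplicativity makes the untilt of `0` equal to all its positive powers, and it is
    -- divisible by `p`; hence it vanishes.
    have h : ∀ n : ℕ, (p : 𝓞_ℂ_[p]) ^ n ∣ (0 : OF p).untilt := fun n => by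
      have h1 : (p : 𝓞_ℂ_[p]) ∣ (0 : OF p).untilt := by
        rw [← Ideal.mem_span_singleton, ← Ideal.Quotient.eq_zero_iff_mem,
          PreTilt.mk_untilt_eq_coeff_zero, map_zero]
      rcases n.eq_zero_or_pos with rfl | hn
      · simp
      · have h2 : (0 : OF p).untilt = (0 : OF p).untilt ^ n := by
          rw [← map_pow, zero_pow hn.ne']
        rw [h2]
        exact pow_dvd_pow_of_dvd h1 n
    have : (0 : OF p).untilt = 0 := by
      refine (IsAdicComplete.toIsHausdorff (I := Ideal.span {(p : 𝓞_ℂ_[p])})).haus' _ fun n => ?_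
      simp only [Ideal.span_singleton_pow, smul_eq_mul, Ideal.mul_top, SModEq.zero,
        Ideal.mem_span_singleton, h]
    rw [this]
    simp
  obtain ⟨n, hn⟩ : ∃ n, PreTilt.coeff n x ≠ 0 := not_forall.1 fun h => hx <| Perfection.ext h
  rw [absF_eq_of_coeff_ne_zero hn]
  rw [← coeff_iterate_frobeniusEquiv_symm_zero, ← PreTilt.mk_untilt_eq_coeff_zero] at hn ⊢
  rw [ModP.preVal_mk (PadicComplexInt.integers p) hn, ← map_pow, ← map_pow,
    PreTilt.untilt_iterate_frobeniusEquiv_symm_pow]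
  rfl

theorem iterate_symm_frobeniusEquiv_pow (x : OF p) (n : ℕ) :
    ((frobeniusEquiv (OF p) p).symm^[n] x) ^ p ^ n = x := by
  rw [← iterate_frobenius]
  exact Function.LeftInverse.iterate (f := (frobeniusEquiv (OF p) p).symm) (g := frobenius (OF p) p)
    (frobenius_apply_frobeniusEquiv_symm (OF p) p) n x

/-- The untilts of the `p ^ n`-th roots of `x` and `y` have quotients in `𝒪_{ℂ_p}`. By cancellation
these form a compatible system under `p`-th powers, and their residues modulo `p` define the
quotient in the tilt. -/
theorem dvd_of_absF_le {x y : OF p} (h : absF p x ≤ absF p y) : y ∣ x := by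
  by_cases hy : y = 0
  · subst hy
    rw [map_zero, nonpos_iff_eq_zero, absF_eq_zero] at h
    rw [h]
  have hle : ∀ n : ℕ, absF p ((frobeniusEquiv (OF p) p).symm^[n] x)
      ≤ absF p ((frobeniusEquiv (OF p) p).symm^[n] y) := fun n => by
    rw [← pow_le_pow_iff_left₀ zero_le zero_le (pow_ne_zero n (Fact.out : p.Prime).ne_zero),
      ← map_pow, ← map_pow, iterate_symm_frobeniusEquiv_pow, iterate_symm_frobeniusEquiv_pow]
    exact h
  have hdvd : ∀ n : ℕ, ((frobeniusEquiv (OF p) p).symm^[n] y).untilt ∣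
      ((frobeniusEquiv (OF p) p).symm^[n] x).untilt := fun n => by
    rw [← (PadicComplexInt.integers p).le_iff_dvd]
    change (PadicComplex.valued p).v _ ≤ (PadicComplex.valued p).v _
    have := hle n
    rwa [← val_untilt, ← val_untilt] at this
  choose z hz using hdvd
  have hne : ∀ n : ℕ, ((frobeniusEquiv (OF p) p).symm^[n] y).untilt ≠ 0 := fun n h0 => by
    have h1 := val_untilt ((frobeniusEquiv (OF p) p).symm^[n] y)
    rw [h0] at h1
    have h2 : absF p ((frobeniusEquiv (OF p) p).symm^[n] y) = 0 := by rw [← h1]; simp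
    rw [absF_eq_zero] at h2
    have h3 := iterate_symm_frobeniusEquiv_pow y n
    rw [h2, zero_pow (pow_ne_zero n (Fact.out : p.Prime).ne_zero)] at h3
    exact hy h3.symm
  have hpow : ∀ (w : OF p) (n : ℕ), ((frobeniusEquiv (OF p) p).symm^[n + 1] w).untilt ^ p
      = ((frobeniusEquiv (OF p) p).symm^[n] w).untilt := fun w n => by
    rw [Function.iterate_succ_apply', ← map_pow, ← frobenius_def,
      frobenius_apply_frobeniusEquiv_symm]
  have hzp : ∀ n, z (n + 1) ^ p = z n := fun n => by
    apply mul_left_cancel₀ (hne n)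
    rw [← hz, ← hpow y, ← mul_pow, ← hz, hpow]
  let w : OF p := ⟨fun n => Ideal.Quotient.mk _ (z n), fun n => by
    rw [← map_pow, hzp]⟩
  refine ⟨w, Perfection.ext fun n => ?_⟩
  change PreTilt.coeff n x = PreTilt.coeff n (y * w)
  rw [map_mul, ← coeff_iterate_frobeniusEquiv_symm_zero, ← PreTilt.mk_untilt_eq_coeff_zero, hz,
    map_mul, PreTilt.mk_untilt_eq_coeff_zero, coeff_iterate_frobeniusEquiv_symm_zero]
  rfl

theorem absF_le_absF_iff_dvd {x y : OF p} : absF p x ≤ absF p y ↔ y ∣ x := by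
  refine ⟨dvd_of_absF_le, ?_⟩
  rintro ⟨z, rfl⟩
  rw [map_mul]
  exact mul_le_of_le_one_right' (absF_le_one p z)

theorem isUnit_iff_absF_eq_one {x : OF p} : IsUnit x ↔ absF p x = 1 := by
  rw [isUnit_iff_dvd_one, ← absF_le_absF_iff_dvd, map_one]
  exact ⟨fun h => le_antisymm (absF_le_one p x) h, fun h => h.ge⟩

theorem exists_pow_lt_inv_p_pow {r : ℝ≥0} (hr : r < 1) (m : ℕ) :
    ∃ N : ℕ, ∀ n ≥ N, r ^ p ^ n ≤ (p : ℝ≥0)⁻¹ ^ m := by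
  have hp : 0 < (p : ℝ≥0)⁻¹ ^ m :=
    pow_pos (inv_pos.mpr (by exact_mod_cast (Fact.out : p.Prime).pos)) _
  obtain ⟨N, hN⟩ := exists_pow_lt_of_lt_one hp hr
  refine ⟨N, fun n hn => le_trans ?_ hN.le⟩
  exact pow_le_pow_of_le_one zero_le hr.le
    (hn.trans (Nat.lt_pow_self (Fact.out : p.Prime).one_lt).le)

/-- A form of the completeness of `𝒪_F`. -/
theorem exists_limit {a : OF p} (ha : absF p a < 1) (s : ℕ → OF p)
    (h : ∀ n, absF p (s (n + 1) - s n) ≤ absF p a ^ p ^ n) :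
    ∃ x, ∀ n, absF p (x - s n) ≤ absF p a ^ p ^ n := by
  have hmono : ∀ m n, m ≤ n → absF p (s n - s m) ≤ absF p a ^ p ^ m := by
    intro m n hmn
    induction n, hmn using Nat.le_induction with
    | base => simp
    | succ n hmn ih =>
      rw [← sub_add_sub_cancel]
      refine Valuation.map_add_le _ ((h n).trans ?_) ih
      exact pow_le_pow_of_le_one zero_le ha.le
        (Nat.pow_le_pow_right (Fact.out : p.Prime).pos hmn)
  have hN : ∀ m, ∃ N : ℕ, ∀ n ≥ N, absF p a ^ p ^ n ≤ (p : ℝ≥0)⁻¹ ^ p ^ m := fun m =>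
    exists_pow_lt_inv_p_pow ha _
  choose N hN using hN
  have hst : ∀ m n k, N m ≤ n → N m ≤ k → PreTilt.coeff m (s n) = PreTilt.coeff m (s k) := by
    have key : ∀ m n k, N m ≤ n → n ≤ k → PreTilt.coeff m (s n) = PreTilt.coeff m (s k) := by
      intro m n k hn hk
      have h0 := coeff_eq_zero_of_absF_le ((hmono n k hk).trans (hN m n hn))
      rw [map_sub, sub_eq_zero] at h0
      exact h0.symm
    intro m n k hn hk
    rcases le_total n k with hnk | hnk
    · exact key m n k hn hnk
    · exact (key m k n hk hnk).symm
  -- The `m`-th coefficient of the limit is the eventually constant value of the `m`-th coefficients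
  -- of the sequence.
  let x : OF p := ⟨fun m => PreTilt.coeff m (s (N m)), fun m => by
    have h1 := hst (m + 1) (N (m + 1)) (max (N m) (N (m + 1))) le_rfl (le_max_right _ _)
    change PreTilt.coeff (m + 1) (s (N (m + 1))) ^ p = PreTilt.coeff m (s (N m))
    rw [hst m (N m) (max (N m) (N (m + 1))) le_rfl (le_max_left _ _), h1]
    exact PreTilt.coeff_pow_p _ m⟩
  refine ⟨x, fun n => ?_⟩
  by_cases ha0 : absF p a = 0
  · have hcon : ∀ m, s m = s 0 := fun m => by
      have := hmono 0 m (Nat.zero_le _)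
      rw [ha0, zero_pow (pow_ne_zero _ (Fact.out : p.Prime).ne_zero), nonpos_iff_eq_zero,
        absF_eq_zero, sub_eq_zero] at this
      exact this
    have hx : x = s n := Perfection.ext fun m => by
      change PreTilt.coeff m (s (N m)) = PreTilt.coeff m (s n)
      rw [hcon, hcon n]
    simp [hx]
  obtain ⟨m, hm⟩ : ∃ m : ℕ, (p : ℝ≥0)⁻¹ ^ p ^ m ≤ absF p a ^ p ^ n := by
    obtain ⟨m, hm⟩ := exists_pow_lt_of_lt_one (pow_pos (pos_of_ne_zero ha0) (p ^ n))
      (inv_lt_one_of_one_lt₀ (a := (p : ℝ≥0)) (by exact_mod_cast (Fact.out : p.Prime).one_lt))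
    refine ⟨m, le_trans ?_ hm.le⟩
    exact pow_le_pow_of_le_one zero_le
      (inv_le_one_of_one_le₀ (by exact_mod_cast (Fact.out : p.Prime).one_lt.le))
      (Nat.lt_pow_self (Fact.out : p.Prime).one_lt).le
  rw [← sub_add_sub_cancel x (s (max (N m) n)) (s n)]
  refine Valuation.map_add_le _ ?_ (hmono _ _ (le_max_right _ _))
  refine (absF_le_of_coeff_eq_zero (n := m) ?_).trans hm
  rw [map_sub, sub_eq_zero]
  exact hst m _ _ le_rfl (le_max_left _ _)

theorem exists_absF_gt {r : ℝ≥0} (hr : r < 1) : ∃ a : OF p, a ≠ 0 ∧ absF p a < 1 ∧ r < absF p a := by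
  -- A square root of `p` is nonzero modulo `p`, so any lift `b` of its residue to the tilt has the
  -- same absolute value. The `p ^ n`-th roots of `b` then have absolute values tending to `1`.
  obtain ⟨z, hz⟩ := IsAlgClosed.exists_pow_nat_eq (p : ℂ_[p]) two_pos
  have hv : (PadicComplex.valued p).v z ^ 2 = (p : ℝ≥0)⁻¹ := by
    rw [← map_pow, hz, PadicComplex.valuation_p, one_div]
  have hp1 : (p : ℝ≥0)⁻¹ < 1 :=
    inv_lt_one_of_one_lt₀ (by exact_mod_cast (Fact.out : p.Prime).one_lt)
  have hp0 : (p : ℝ≥0)⁻¹ ≠ 0 := inv_ne_zero (by exact_mod_cast (Fact.out : p.Prime).ne_zero)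
  have hz1 : (PadicComplex.valued p).v z < 1 := by
    rw [← hv] at hp1
    exact (pow_lt_one_iff two_ne_zero).mp hp1
  obtain ⟨b, hb⟩ := coeff_zero_surjective p (Ideal.Quotient.mk _ ⟨z, hz1.le⟩)
  have hne : (Ideal.Quotient.mk _ ⟨z, hz1.le⟩ : ModP 𝓞_ℂ_[p] p) ≠ 0 := by
    rw [← ModP.v_p_lt_val (PadicComplexInt.integers p), PadicComplex.valuation_p, one_div, ← hv]
    change _ < (PadicComplex.valued p).v z
    have hz0 : 0 < (PadicComplex.valued p).v z := pos_of_ne_zero fun h => by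
      rw [h] at hv; exact hp0 (by rw [← hv]; simp)
    calc _ = (PadicComplex.valued p).v z * (PadicComplex.valued p).v z := sq _
      _ < 1 * (PadicComplex.valued p).v z := mul_lt_mul_of_pos_right hz1 hz0
      _ = _ := one_mul _
  have hbv : absF p b = (PadicComplex.valued p).v z := by
    rw [absF_eq_of_coeff_ne_zero (n := 0) (by rwa [hb]), hb,
      ModP.preVal_mk (PadicComplexInt.integers p) hne, pow_zero, pow_one]
    rfl
  have hb1 : absF p b < 1 := hbv.trans_lt hz1
  have hb0 : b ≠ 0 := fun h => by
    rw [h, map_zero] at hb; exact hne hb.symm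
  obtain ⟨n, hn⟩ := exists_pow_lt_of_lt_one (pos_of_ne_zero ((absF_eq_zero p).not.mpr hb0)) hr
  have hpow : absF p ((frobeniusEquiv (OF p) p).symm^[n] b) ^ p ^ n = absF p b := by
    rw [← map_pow, iterate_symm_frobeniusEquiv_pow]
  have hpn : p ^ n ≠ 0 := pow_ne_zero _ (Fact.out : p.Prime).ne_zero
  refine ⟨(frobeniusEquiv (OF p) p).symm^[n] b, fun h => hb0 ?_, ?_, ?_⟩
  · rw [← iterate_symm_frobeniusEquiv_pow b n, h, zero_pow hpn]
  · rw [← hpow] at hb1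
    exact (pow_lt_one_iff hpn).mp hb1
  · refine lt_of_pow_lt_pow_left₀ (p ^ n) zero_le ?_
    rw [hpow]
    exact lt_of_le_of_lt (pow_le_pow_of_le_one zero_le hr.le
      (Nat.lt_pow_self (Fact.out : p.Prime).one_lt).le) hn

open Polynomial in
/-- A monic polynomial over `𝒪_F` has roots modulo every nonzero element. -/
theorem exists_dvd_eval {P : (OF p)[X]} (hP : P.Monic) (hdeg : P.natDegree ≠ 0) {b : OF p}
    (hb : b ≠ 0) : ∃ x, b ∣ P.eval x := by
  obtain ⟨n, hn⟩ : ∃ n : ℕ, (p : ℝ≥0)⁻¹ ^ p ^ n ≤ absF p b := by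
    obtain ⟨m, hm⟩ := exists_pow_lt_of_lt_one (pos_of_ne_zero ((absF_eq_zero p).not.mpr hb))
      (inv_lt_one_of_one_lt₀ (a := (p : ℝ≥0)) (by exact_mod_cast (Fact.out : p.Prime).one_lt))
    refine ⟨m, le_trans ?_ hm.le⟩
    exact pow_le_pow_of_le_one zero_le
      (inv_le_one_of_one_le₀ (by exact_mod_cast (Fact.out : p.Prime).one_lt.le))
      (Nat.lt_pow_self (Fact.out : p.Prime).one_lt).le
  -- The choice of `n` puts the kernel of `f` inside `(b)`. So it suffices to find a root of the
  -- image of `P` modulo `p`, and this comes from an integral root in `ℂ_p` of a monic lift.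
  let f : OF p →+* ModP 𝓞_ℂ_[p] p := PreTilt.coeff n
  obtain ⟨R, hR, hRdeg, hRm⟩ := lifts_and_natDegree_eq_and_monic
    (f := Ideal.Quotient.mk (Ideal.span {(p : 𝓞_ℂ_[p])})) (p := P.map f) (by
      rw [lifts_iff_coeff_lifts]
      intro k
      exact Ideal.Quotient.mk_surjective _) (hP.map f)
  rw [hP.natDegree_map] at hRdeg
  obtain ⟨r, hr⟩ := IsAlgClosed.exists_root (R.map (algebraMap 𝓞_ℂ_[p] ℂ_[p])) (by
    rw [hRm.degree_map, degree_eq_natDegree hRm.ne_zero, hRdeg]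
    exact_mod_cast hdeg)
  have hint : IsIntegral 𝓞_ℂ_[p] r := ⟨R, hRm, by rwa [IsRoot.def, eval_map] at hr⟩
  obtain ⟨r, rfl⟩ := IsIntegrallyClosed.isIntegral_iff.mp hint
  have hr0 : R.eval r = 0 := by
    apply (FaithfulSMul.algebraMap_injective 𝓞_ℂ_[p] ℂ_[p])
    rw [map_zero, ← eval_map_apply]
    exact hr
  obtain ⟨x, hfx⟩ : ∃ x : OF p, f x = Ideal.Quotient.mk _ r :=
    Perfection.coeff_surjective (frobenius_ModP_surjective p) n (Ideal.Quotient.mk _ r)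
  refine ⟨x, dvd_of_absF_le (le_trans (absF_le_of_coeff_eq_zero (n := n) ?_) hn)⟩
  change f (P.eval x) = 0
  rw [← eval_map_apply]
  rw [hfx, ← hR, eval_map_apply, hr0, map_zero]

end TiltValuation

/-! ### The quotient `O = W(𝒪_F) / ([a] - p)` -/

section WittQuotient

variable {p : ℕ} [Fact p.Prime]

theorem p_dvd_iff_constantCoeff_eq_zero (f : Ainf p) :
    (p : Ainf p) ∣ f ↔ WittVector.constantCoeff f = 0 := by
  rw [← Ideal.mem_span_singleton, WittVector.mem_span_p_iff_coeff_zero_eq_zero]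
  rfl

theorem constantCoeff_teich (x : OF p) : WittVector.constantCoeff (teich x) = x :=
  WittVector.teichmuller_coeff_zero p x

theorem exists_eq_teich_add_mul (f : Ainf p) :
    ∃ g, f = teich (WittVector.constantCoeff f) + p * g := by
  obtain ⟨g, hg⟩ : (p : Ainf p) ∣ f - teich (WittVector.constantCoeff f) := by
    rw [p_dvd_iff_constantCoeff_eq_zero, map_sub, constantCoeff_teich, sub_self]
  exact ⟨g, by rw [← hg]; ring⟩

theorem isUnit_one_add_p_mul (g : Ainf p) : IsUnit (1 + (p : Ainf p) * g) := by
  have h := IsAdicComplete.le_jacobson_bot (Ideal.span {(p : Ainf p)})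
    (Ideal.mem_span_singleton_self _)
  have := Ideal.mem_jacobson_bot.mp h g
  rwa [add_comm]

theorem isUnit_of_isUnit_constantCoeff {f : Ainf p} (h : IsUnit (WittVector.constantCoeff f)) :
    IsUnit f := by
  obtain ⟨x, hx⟩ := h.exists_right_inv
  obtain ⟨g, hg⟩ : (p : Ainf p) ∣ f * teich x - 1 := by
    rw [p_dvd_iff_constantCoeff_eq_zero, map_sub, map_mul, constantCoeff_teich, hx, map_one,
      sub_self]
  have hu := isUnit_one_add_p_mul g
  rw [← hg, add_sub_cancel] at hu
  exact isUnit_of_mul_isUnit_left hu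

theorem eq_zero_of_forall_p_pow_dvd {f : Ainf p} (h : ∀ n : ℕ, (p : Ainf p) ^ n ∣ f) : f = 0 := by
  refine (IsAdicComplete.toIsHausdorff (I := Ideal.span {(p : Ainf p)})).haus' _ fun n => ?_
  simp only [Ideal.span_singleton_pow, smul_eq_mul, Ideal.mul_top, SModEq.zero,
    Ideal.mem_span_singleton, h]

theorem exists_sum_p_pow_mul (d : ℕ → Ainf p) :
    ∃ L, ∀ n, (p : Ainf p) ^ n ∣ L - ∑ i ∈ Finset.range n, (p : Ainf p) ^ i * d i := by
  obtain ⟨L, hL⟩ := (IsAdicComplete.toIsPrecomplete (I := Ideal.span {(p : Ainf p)})).prec'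
    (fun n => ∑ i ∈ Finset.range n, (p : Ainf p) ^ i * d i) (fun {m n} hmn => by
      simp only [Ideal.span_singleton_pow, smul_eq_mul, Ideal.mul_top, SModEq.sub_mem,
        Ideal.mem_span_singleton]
      rw [dvd_sub_comm, ← Finset.sum_Ico_eq_sub _ hmn]
      exact Finset.dvd_sum fun i hi =>
        (pow_dvd_pow _ (Finset.mem_Ico.mp hi).1).mul_right _)
  refine ⟨L, fun n => ?_⟩
  have := hL n
  simp only [Ideal.span_singleton_pow, smul_eq_mul, Ideal.mul_top, SModEq.sub_mem,
    Ideal.mem_span_singleton] at this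
  rwa [dvd_sub_comm]

/-- A presentation `η` of the quotient of `W(𝒪_F)` by `([a] - p)` with `0 < |a|_F < 1`, in which `p`
is a regular element. -/
structure IsUntilt {O : Type*} [CommRing O] (a : OF p) (η : Ainf p →+* O) : Prop where
  ne_zero : a ≠ 0
  lt_one : absF p a < 1
  surjective : Function.Surjective η
  ker_eq : RingHom.ker η = Ideal.span {teich a - (p : Ainf p)}
  regular : ∀ x : O, (p : O) * x = 0 → x = 0

namespace IsUntilt

variable {O : Type*} [CommRing O] {a : OF p} {η : Ainf p →+* O} (hη : IsUntilt a η)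
include hη

theorem map_teich : η (teich a) = p := by
  have : teich a - (p : Ainf p) ∈ RingHom.ker η := by
    rw [hη.ker_eq]; exact Ideal.mem_span_singleton_self _
  rw [RingHom.mem_ker, map_sub, map_natCast, sub_eq_zero] at this
  exact this

theorem dvd_of_map_eq_zero {f : Ainf p} (h : η f = 0) : teich a - (p : Ainf p) ∣ f := by
  rw [← Ideal.mem_span_singleton, ← hη.ker_eq]
  exact h

theorem mul_left_cancel_p_pow {n : ℕ} {x y : O} (h : (p : O) ^ n * x = (p : O) ^ n * y) :
    x = y := by
  induction n with
  | zero => simpa using h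
  | succ n ih =>
    apply ih
    rw [pow_succ', mul_assoc, mul_assoc, ← sub_eq_zero, ← mul_sub] at h
    exact sub_eq_zero.mp (hη.regular _ h)

/-- This is the isomorphism `O / p = W(𝒪_F) / (p, [a]) = 𝒪_F / a`, which carries questions modulo
`p` over to `𝒪_F`. -/
theorem p_dvd_iff (f : Ainf p) : (p : O) ∣ η f ↔ a ∣ WittVector.constantCoeff f := by
  constructor
  · rintro ⟨c, hc⟩
    obtain ⟨g, rfl⟩ := hη.surjective c
    obtain ⟨h, hh⟩ := hη.dvd_of_map_eq_zero (f := f - p * g) (by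
      rw [map_sub, map_mul, map_natCast, hc, sub_self])
    refine ⟨WittVector.constantCoeff h, ?_⟩
    have := congrArg WittVector.constantCoeff hh
    have hp : WittVector.constantCoeff (p : Ainf p) = 0 :=
      (p_dvd_iff_constantCoeff_eq_zero _).mp dvd_rfl
    rwa [map_sub, map_mul, map_mul, map_sub, constantCoeff_teich, hp, zero_mul, sub_zero,
      sub_zero] at this
  · rintro ⟨r, hr⟩
    obtain ⟨g, hg⟩ := exists_eq_teich_add_mul f
    rw [hg, hr, map_add, map_mul η, map_natCast, teich, map_mul, map_mul, hη.map_teich]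
    exact dvd_add (dvd_mul_right _ _) (dvd_mul_right _ _)

theorem exists_eq_teich_add (c : O) : ∃ x e, c = η (teich x) + p * e := by
  obtain ⟨f, rfl⟩ := hη.surjective c
  obtain ⟨g, hg⟩ := exists_eq_teich_add_mul f
  refine ⟨WittVector.constantCoeff f, η g, ?_⟩
  conv_lhs => rw [hg]
  simp

theorem isUnit_of_p_dvd_sub {c d : O} (hc : IsUnit c) (h : (p : O) ∣ d - c) : IsUnit d := by
  obtain ⟨e, he⟩ := h
  obtain ⟨b, hb⟩ := hc.exists_right_inv
  obtain ⟨g, hg⟩ := hη.surjective (b * e)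
  have hu := (isUnit_one_add_p_mul g).map η
  have : d = c * η (1 + p * g) := by
    rw [map_add, map_one, map_mul, map_natCast, hg]
    linear_combination he - (p : O) * e * hb
  rw [this]
  exact hc.mul hu

/-- Separatedness does not pass to quotients automatically. Writing `c` as the image of `p ^ n * g
n`, regularity of `p` gives `g n - p * g (n + 1) = ([a] - p) * k n`. Telescoping and summing `∑ p ^
i * k i` in the complete ring `W(𝒪_F)` shows that `[a] - p` divides `g 0`. -/
theorem eq_zero_of_forall_dvd {c : O} (h : ∀ n : ℕ, (p : O) ^ n ∣ c) : c = 0 := by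
  obtain ⟨f, rfl⟩ := hη.surjective c
  have hg : ∀ n : ℕ, ∃ g : Ainf p, η f = η (p ^ n * g) := fun n => by
    obtain ⟨e, he⟩ := h n
    obtain ⟨g, rfl⟩ := hη.surjective e
    exact ⟨g, by rw [he, map_mul, map_pow, map_natCast]⟩
  choose g hg using hg
  have hk : ∀ n : ℕ, ∃ k, g n - p * g (n + 1) = (teich a - (p : Ainf p)) * k := fun n => by
    apply hη.dvd_of_map_eq_zero
    rw [map_sub, sub_eq_zero]
    apply hη.mul_left_cancel_p_pow (n := n)
    have := (hg n).symm.trans (hg (n + 1))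
    rw [map_mul, map_mul, map_pow, map_pow, map_natCast] at this
    rw [this, map_mul, map_natCast]
    ring
  choose k hk using hk
  obtain ⟨L, hL⟩ := exists_sum_p_pow_mul k
  have hs : ∀ n, g 0 - (teich a - (p : Ainf p)) * ∑ i ∈ Finset.range n, (p : Ainf p) ^ i * k i
      = p ^ n * g n := fun n => by
    induction n with
    | zero => simp
    | succ n ih =>
      rw [Finset.sum_range_succ, mul_add, ← sub_sub, ih]
      linear_combination (p : Ainf p) ^ n * hk n
  have h0 : g 0 - (teich a - (p : Ainf p)) * L = 0 := by
    refine eq_zero_of_forall_p_pow_dvd fun n => ?_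
    have h1 := (dvd_mul_right ((p : Ainf p) ^ n) (g n)).sub ((hL n).mul_left (teich a - (p : Ainf p)))
    rw [← hs n] at h1
    convert h1 using 1
    ring
  have hg0 : η (g 0) = 0 := by
    rw [sub_eq_zero.mp h0, map_mul, map_sub, hη.map_teich, map_natCast, sub_self, zero_mul]
  rw [hg 0, map_mul, hg0, mul_zero]

theorem exists_limit (s : ℕ → O) (h : ∀ n, (p : O) ^ n ∣ s (n + 1) - s n) :
    ∃ L, ∀ n, (p : O) ^ n ∣ L - s n := by
  have hd : ∀ n, ∃ d, s (n + 1) - s n = p ^ n * η d := fun n => by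
    obtain ⟨e, he⟩ := h n
    obtain ⟨d, rfl⟩ := hη.surjective e
    exact ⟨d, he⟩
  choose d hd using hd
  obtain ⟨L, hL⟩ := exists_sum_p_pow_mul d
  refine ⟨s 0 + η L, fun n => ?_⟩
  have hs : s n = s 0 + η (∑ i ∈ Finset.range n, (p : Ainf p) ^ i * d i) := by
    induction n with
    | zero => simp
    | succ n ih =>
      rw [Finset.sum_range_succ, map_add, ← add_assoc, ← ih, map_mul, map_pow, map_natCast, ← hd]
      ring
  rw [hs, add_sub_add_left_eq_sub, ← map_sub]
  have := map_dvd η (hL n)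
  rwa [map_pow, map_natCast] at this

open Polynomial in
-- Through `O / p = 𝒪_F / a` this is `exists_dvd_eval` with `b = a`, and a Teichmüller
-- representative of the root found there serves as `t`.
theorem exists_p_dvd_eval {P : O[X]} (hP : P.Monic) (hdeg : P.natDegree ≠ 0) :
    ∃ t, (p : O) ∣ P.eval t := by
  obtain ⟨R, hR, hRdeg, hRm⟩ := lifts_and_natDegree_eq_and_monic (f := η) (p := P) (by
      rw [lifts_iff_coeff_lifts]
      intro k
      exact hη.surjective _) hP
  obtain ⟨x, hx⟩ := exists_dvd_eval (hRm.map (WittVector.constantCoeff (p := p) (R := OF p)))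
    (by rwa [hRm.natDegree_map, hRdeg]) hη.ne_zero
  refine ⟨η (teich x), ?_⟩
  rw [← hR, eval_map_apply, hη.p_dvd_iff, ← eval_map_apply, constantCoeff_teich]
  exact hx

end IsUntilt

end WittQuotient

/-! ### `p`-th roots of units and Teichmüller lifts in `O` -/

section PthRoots

/-- The second order expansion of a `p`-th power. -/
theorem exists_add_pow_prime_expansion {R : Type*} [CommRing R] {p : ℕ} (hp : p.Prime) (y z : R) :
    ∃ r, (y + z) ^ p = y ^ p + p * y ^ (p - 1) * z + p * z ^ 2 * r + z ^ p := by
  have h1 : 1 ∈ Finset.Ioo 0 p := Finset.mem_Ioo.mpr ⟨one_pos, hp.one_lt⟩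
  have hd : ∀ k ∈ (Finset.Ioo 0 p).erase 1, z ^ 2 ∣
      z ^ k * y ^ (p - k) * ((p.choose k / p : ℕ) : R) := by
    intro k hk
    have h2 : 2 ≤ k := by
      have := Finset.mem_erase.mp hk
      have := (Finset.mem_Ioo.mp this.2).1
      omega
    exact ((pow_dvd_pow z h2).mul_right _).mul_right _
  obtain ⟨r, hr⟩ := Finset.dvd_sum hd
  refine ⟨r, ?_⟩
  rw [add_comm y z, add_pow_prime_eq' hp, ← Finset.add_sum_erase _ _ h1, hr,
    Nat.choose_one_right, Nat.div_self hp.pos]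
  push_cast
  ring

open Polynomial in
theorem exists_polynomial_add_mul_pow_prime {R : Type*} [CommRing R] {p : ℕ}
    (hp : p.Prime) (y d : R) : ∃ S : R[X], S.degree < (p : WithBot ℕ) ∧
      ∀ t, (y + d * t) ^ p = y ^ p + d ^ p * t ^ p + p * d * S.eval t := by
  refine ⟨∑ k ∈ Finset.Ioo 0 p, C (d ^ (k - 1) * y ^ (p - k) * ((p.choose k / p : ℕ) : R)) * X ^ k,
    ?_, fun t => ?_⟩
  · rw [← mem_degreeLT]
    refine Submodule.sum_mem _ fun k hk => ?_
    rw [mem_degreeLT]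
    exact lt_of_le_of_lt (degree_C_mul_X_pow_le _ _)
      (by exact_mod_cast (Finset.mem_Ioo.mp hk).2)
  · rw [add_comm, add_pow_prime_eq' hp, eval_finsetSum, mul_pow, add_comm (d ^ p * t ^ p),
      mul_assoc (p : R) d, Finset.mul_sum _ _ d]
    congr 2
    refine Finset.sum_congr rfl fun k hk => ?_
    obtain ⟨m, rfl⟩ := Nat.exists_eq_add_of_lt (Finset.mem_Ioo.mp hk).1
    simp only [eval_mul, eval_C, eval_pow, eval_X, zero_add, Nat.add_sub_cancel]
    ring

namespace IsUntilt

variable {p : ℕ} [Fact p.Prime] {O : Type*} [CommRing O] {a : OF p} {η : Ainf p →+* O}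
  (hη : IsUntilt a η)
include hη

theorem nontrivial : Nontrivial O := by
  refine ⟨⟨0, 1, fun h => ?_⟩⟩
  have h1 : (p : O) ∣ η 1 := by rw [map_one, ← h]; exact dvd_zero _
  rw [hη.p_dvd_iff, map_one, ← absF_le_absF_iff_dvd, map_one] at h1
  exact hη.lt_one.not_ge h1

open Polynomial in
-- Write `δ` also for the image of `[δ]`. As `δ ^ (p - 1)` divides `p`, the middle terms of `(y + δ
-- t) ^ p` are divisible by `δ ^ p`, like `δ ^ p t ^ p` and the error `y ^ p - u`. Dividing by `δ ^
-- p` leaves a monic equation of degree `p` in `t`, and a root of it modulo `p` gains a factor `p`,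
-- the image of `[a]`.
theorem exists_better_pth_root {u y : O} {δ : OF p} (hδ : δ ^ (p - 1) ∣ a)
    (h : η (teich (δ ^ p)) ∣ y ^ p - u) : ∃ y', η (teich (δ ^ p * a)) ∣ y' ^ p - u := by
  have := hη.nontrivial
  have hp : p.Prime := Fact.out
  obtain ⟨c, hc⟩ := hδ
  obtain ⟨e, he⟩ := h
  have hpc : (p : O) = η (teich δ) ^ (p - 1) * η (teich c) := by
    rw [← hη.map_teich, hc, teich, teich, teich, map_mul, map_pow, map_mul, map_pow]
  obtain ⟨S, hS, hSt⟩ := exists_polynomial_add_mul_pow_prime hp y (η (teich δ))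
  have hdeg : (C (η (teich c)) * S + C e).degree < (p : WithBot ℕ) := by
    refine (degree_add_le _ _).trans_lt (max_lt ?_ ?_)
    · refine lt_of_le_of_lt (degree_mul_le _ _) ?_
      refine lt_of_le_of_lt (add_le_add_left degree_C_le _) ?_
      rwa [zero_add]
    · exact degree_C_le.trans_lt (by exact_mod_cast hp.pos)
  obtain ⟨t, ht⟩ := hη.exists_p_dvd_eval (monic_X_pow_add hdeg) (by
    rw [natDegree_add_eq_left_of_degree_lt (by rwa [degree_X_pow]), natDegree_X_pow]
    exact hp.ne_zero)
  refine ⟨y + η (teich δ) * t, ?_⟩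
  have hpp : (p : O) * η (teich δ) = η (teich δ) ^ p * η (teich c) := by
    rw [hpc, ← pow_sub_one_mul hp.ne_zero (η (teich δ))]
    ring
  have key : (y + η (teich δ) * t) ^ p - u = η (teich δ) ^ p *
      eval t (X ^ p + (C (η (teich c)) * S + C e)) := by
    rw [hSt, hpp]
    rw [teich, map_pow, map_pow] at he
    simp only [eval_add, eval_mul, eval_pow, eval_X, eval_C]
    linear_combination he
  rw [key, teich, map_mul, map_mul, map_pow, map_pow, hη.map_teich]
  exact mul_dvd_mul_left _ ht

/-- A starting point for Newton iteration; `k + 2 ≤ k * p` is what makes the term `z ^ p` of the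
correction negligible. The initial approximation is modulo `p`, and `δ = a ^ (1 / p)` improves it to
`p ^ 2`. -/
theorem exists_p_pow_dvd_pow_sub (u : O) :
    ∃ (k : ℕ) (y : O), k + 2 ≤ k * p ∧ (p : O) ^ (k + 1) ∣ y ^ p - u := by
  have hp : p.Prime := Fact.out
  obtain ⟨x, e, hx⟩ := hη.exists_eq_teich_add u
  have hroot : ∀ b : OF p, (frobeniusEquiv (OF p) p).symm b ^ p = b :=
    frobenius_apply_frobeniusEquiv_symm (OF p) p
  have h0 : η (teich ((frobeniusEquiv (OF p) p).symm a ^ p)) ∣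
      η (teich ((frobeniusEquiv (OF p) p).symm x)) ^ p - u := by
    rw [hroot, ← map_pow, ← map_pow, hroot, hx, hη.map_teich]
    exact ⟨-e, by ring⟩
  obtain ⟨y, hy⟩ := hη.exists_better_pth_root (by
    conv_rhs => rw [← hroot a]
    exact pow_dvd_pow _ (Nat.sub_le _ _)) h0
  rw [hroot] at hy
  -- For `p = 2` the inequality forces `k ≥ 2`, so a second improvement, now with `δ = a`, is needed
  -- to reach `p ^ 3`.
  by_cases hp2 : p = 2
  · have h1 : η (teich (a ^ p)) ∣ y ^ p - u := by
      rwa [(congrArg (a ^ ·) hp2).trans (sq a)]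
    obtain ⟨y', hy'⟩ := hη.exists_better_pth_root (dvd_of_eq <|
      (congrArg (a ^ ·) (show p - 1 = 1 by omega)).trans (pow_one a)) h1
    refine ⟨2, y', by omega, ?_⟩
    rw [teich, map_mul, map_mul, map_pow, map_pow, hη.map_teich, ← pow_succ] at hy'
    convert hy' using 2
    omega
  · refine ⟨1, y, ?_, ?_⟩
    · have := hp.two_le
      omega
    · rwa [teich, map_mul, map_mul, hη.map_teich, ← sq] at hy

theorem exists_pth_root {u : O} (hu : IsUnit u) : ∃ y, IsUnit y ∧ y ^ p = u := by
  have hp : p.Prime := Fact.out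
  have hunit : ∀ (y : O) (m : ℕ), (p : O) ^ (m + 1) ∣ y ^ p - u → IsUnit y := fun y m h =>
    (isUnit_pow_iff hp.ne_zero).mp
      (hη.isUnit_of_p_dvd_sub hu ((dvd_pow_self _ m.succ_ne_zero).trans h))
  obtain ⟨k, y₀, hk, hy₀⟩ := hη.exists_p_pow_dvd_pow_sub u
  have step : ∀ (n : ℕ) (y : {y : O // (p : O) ^ (k + n + 1) ∣ y ^ p - u}),
      ∃ y' : {y : O // (p : O) ^ (k + (n + 1) + 1) ∣ y ^ p - u},
        (p : O) ^ (k + n) ∣ (y' : O) - y := by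
    rintro n ⟨y, hy⟩
    obtain ⟨w, hw⟩ := ((hunit y _ hy).pow (p - 1)).exists_right_inv
    obtain ⟨e, he⟩ := hy
    -- The Newton correction: `w` inverts `y ^ (p - 1)`, so the linear term cancels the error `p ^
    -- (k + n + 1) * e`. What remains is divisible by `p ^ (2 * (k + n) + 1)` or by `p ^ ((k + n) *
    -- p)`.
    obtain ⟨r, hr⟩ := exists_add_pow_prime_expansion hp y (p ^ (k + n) * (-(e * w)))
    refine ⟨⟨y + p ^ (k + n) * (-(e * w)), ?_⟩, ⟨-(e * w), by ring⟩⟩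
    have hk0 : k ≠ 0 := by rintro rfl; omega
    have hm : k + (n + 1) + 1 ≤ (k + n) * p := by
      have := hp.two_le
      have : n * 1 ≤ n * p := Nat.mul_le_mul_left _ hp.one_le
      rw [add_mul]
      omega
    have key : (y + p ^ (k + n) * (-(e * w))) ^ p - u
        = p ^ (2 * (k + n) + 1) * ((e * w) ^ 2 * r) + p ^ ((k + n) * p) * (-(e * w)) ^ p := by
      rw [hr, mul_pow _ _ p, ← pow_mul]
      linear_combination he - (p : O) ^ (k + n + 1) * e * hw
    rw [key]
    exact dvd_add ((pow_dvd_pow _ (by omega)).mul_right _) ((pow_dvd_pow _ hm).mul_right _)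
  choose f hf using step
  let s : ∀ n : ℕ, {y : O // (p : O) ^ (k + n + 1) ∣ y ^ p - u} := fun n =>
    Nat.rec (motive := fun n => {y : O // (p : O) ^ (k + n + 1) ∣ y ^ p - u}) ⟨y₀, hy₀⟩ f n
  have hs : ∀ n : ℕ, (p : O) ^ n ∣ (s (n + 1) : O) - (s n : O) := fun n =>
    (pow_dvd_pow _ (Nat.le_add_left n k)).trans (hf n (s n))
  obtain ⟨L, hL⟩ := hη.exists_limit (fun n => (s n : O)) hs
  have hLu : L ^ p = u := by
    refine sub_eq_zero.mp (hη.eq_zero_of_forall_dvd fun n => ?_)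
    rw [← sub_add_sub_cancel _ ((s n : O) ^ p)]
    exact dvd_add ((hL n).trans (sub_dvd_pow_sub_pow _ _ _))
      ((pow_dvd_pow _ (by omega)).trans (s n).2)
  exact ⟨L, (isUnit_pow_iff hp.ne_zero).mp (hLu ▸ hu), hLu⟩

/-- Every unit of the quotient has a Teichmüller lift. -/
theorem exists_teich_eq_of_isUnit {u : O} (hu : IsUnit u) : ∃ x, η (teich x) = u := by
  have hp : p.Prime := Fact.out
  choose r hr using fun v : Oˣ => hη.exists_pth_root v.isUnit
  let c : ℕ → Oˣ := fun n =>
    Nat.rec (motive := fun _ => Oˣ) hu.unit (fun _ v => (hr v).1.unit) n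
  have hc : ∀ n : ℕ, (c (n + 1) : O) ^ p = (c n : O) := fun n => by
    rw [show c (n + 1) = (hr (c n)).1.unit from rfl, IsUnit.unit_spec]
    exact (hr (c n)).2
  have hcn : ∀ n : ℕ, (c n : O) ^ p ^ n = u := fun n => by
    induction n with
    | zero => rw [pow_zero, pow_one]; rfl
    | succ n ih => rw [pow_succ', pow_mul, hc, ih]
  choose x e hx using fun n => hη.exists_eq_teich_add (c n : O)
  -- The residues `x n` of the roots `c n = u ^ (1 / p ^ n)` are compatible modulo `a`. By Frobenius
  -- the sequence `x n ^ p ^ n` then converges, and its limit is the lift.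
  have hxp : ∀ n, a ∣ x (n + 1) ^ p - x n := fun n => by
    have h1 : (p : O) ∣ η (teich (x (n + 1)) ^ p - teich (x n)) := by
      have h2 : η (teich (x n)) = c n - p * e n := by rw [hx n]; ring
      have h3 : η (teich (x (n + 1))) = c (n + 1) - p * e (n + 1) := by rw [hx (n + 1)]; ring
      have h4 : ((c (n + 1) : O) - p * e (n + 1)) - (c (n + 1) : O) ∣
          ((c (n + 1) : O) - p * e (n + 1)) ^ p - (c (n + 1) : O) ^ p := sub_dvd_pow_sub_pow _ _ _
      have h5 : (p : O) ∣ ((c (n + 1) : O) - p * e (n + 1)) ^ p - (c (n + 1) : O) ^ p :=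
        dvd_trans ⟨-e (n + 1), by ring⟩ h4
      rw [map_sub, map_pow, h2, h3, ← hc n, ← sub_add]
      exact dvd_add h5 (dvd_mul_right _ _)
    rw [hη.p_dvd_iff, map_sub, map_pow, constantCoeff_teich, constantCoeff_teich] at h1
    exact h1
  obtain ⟨z, hz⟩ := FarguesFontaine.exists_limit hη.lt_one (fun n => x n ^ p ^ n) fun n => by
    rw [pow_succ' p, pow_mul, ← sub_pow_expChar_pow, map_pow]
    exact pow_le_pow_left' (absF_le_absF_iff_dvd.mpr (hxp n)) _
  refine ⟨z, sub_eq_zero.mp (hη.eq_zero_of_forall_dvd fun n => ?_)⟩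
  have hroot := iterate_symm_frobeniusEquiv_pow z n
  set w := (frobeniusEquiv (OF p) p).symm^[n] z
  have h1 : a ∣ w - x n := by
    have := hz n
    rw [← hroot, ← sub_pow_expChar_pow, map_pow,
      pow_le_pow_iff_left₀ zero_le zero_le (pow_ne_zero n hp.ne_zero)] at this
    exact dvd_of_absF_le this
  have h2 : (p : O) ∣ η (teich w) - c n := by
    have h3 : (p : O) ∣ η (teich w - teich (x n)) := by
      rw [hη.p_dvd_iff, map_sub, constantCoeff_teich, constantCoeff_teich]
      exact h1
    rw [map_sub] at h3
    rw [hx n, ← sub_sub]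
    exact dvd_sub h3 (dvd_mul_right _ _)
  -- A congruence modulo `p` becomes one modulo `p ^ (n + 1)` between `p ^ n`-th powers.
  have h4 := dvd_sub_pow_of_dvd_sub h2 n
  rw [hcn, ← map_pow, ← map_pow, hroot] at h4
  exact (pow_dvd_pow _ n.le_succ).trans h4

/-- Every divisor of a power of `p` has a Teichmüller lift. -/
theorem exists_teich_eq_of_dvd {c : O} {k : ℕ} (hc : c ∣ (p : O) ^ k) : ∃ x, η (teich x) = c := by
  induction k generalizing c with
  | zero => exact hη.exists_teich_eq_of_isUnit (isUnit_of_dvd_one (by simpa using hc))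
  | succ k ih =>
    obtain ⟨x, e, hx⟩ := hη.exists_eq_teich_add c
    -- If `a ∣ x`, then `p` divides `c` and the induction applies to `c / p`. Otherwise `a = x * m`
    -- with `|m| < 1`, and `c` is the image of `[x]` times a unit.
    by_cases hax : a ∣ x
    · obtain ⟨b, hb⟩ := hax
      obtain ⟨w, hw⟩ := hc
      have hc' : c = p * (η (teich b) + e) := by
        rw [hx, hb, teich, map_mul, map_mul, hη.map_teich]
        ring
      obtain ⟨z, hz⟩ := ih (c := η (teich b) + e) ⟨w, by
        apply hη.mul_left_cancel_p_pow (n := 1)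
        rw [hc'] at hw
        linear_combination hw⟩
      refine ⟨a * z, ?_⟩
      rw [teich, map_mul, map_mul, hz, hη.map_teich, hc']
    · have hlt : absF p a < absF p x := by
        rw [← absF_le_absF_iff_dvd, not_le] at hax
        exact hax
      obtain ⟨m, hm⟩ := dvd_of_absF_le hlt.le
      have hm1 : absF p m < 1 := by
        rw [hm, map_mul] at hlt
        by_contra h
        exact hlt.not_ge (le_mul_of_one_le_right' (not_lt.mp h))
      obtain ⟨f, rfl⟩ := hη.surjective e
      have hu : IsUnit (1 + teich m * f) := by
        apply isUnit_of_isUnit_constantCoeff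
        rw [isUnit_iff_absF_eq_one, map_add, map_one, map_mul, constantCoeff_teich]
        have : absF p (m * WittVector.constantCoeff f) < absF p 1 := by
          rw [map_mul, map_one]
          exact mul_lt_one_of_lt_of_le hm1 (absF_le_one p _)
        rw [Valuation.map_add_eq_of_lt_left _ this, map_one]
      obtain ⟨z, hz⟩ := hη.exists_teich_eq_of_isUnit (hu.map η)
      refine ⟨x * z, ?_⟩
      rw [teich, map_mul, map_mul, hz, hx, ← hη.map_teich, hm]
      simp only [teich, map_mul, map_add, map_one]
      ring

/-- Otherwise `x = a ^ k * m` with `|m| < 1`. Cancelling `p ^ k` would make the image of `[m]` a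
unit of `O`, which is impossible modulo `p`, that is, in `𝒪_F / a`. -/
theorem absF_pow_le_of_dvd {x : OF p} {k : ℕ} (h : η (teich x) ∣ (p : O) ^ k) :
    absF p a ^ k ≤ absF p x := by
  by_contra hlt
  rw [not_le, ← map_pow] at hlt
  obtain ⟨m, hm⟩ := dvd_of_absF_le hlt.le
  have hm1 : absF p m < 1 := by
    rw [hm, map_mul] at hlt
    by_contra h
    exact hlt.not_ge (le_mul_of_one_le_right' (not_lt.mp h))
  obtain ⟨w, hw⟩ := h
  obtain ⟨f, rfl⟩ := hη.surjective w
  have h1 : 1 = η (teich m * f) := by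
    apply hη.mul_left_cancel_p_pow (n := k)
    conv_lhs => rw [mul_one, hw, hm]
    rw [teich, map_mul, map_mul, map_pow, map_pow, hη.map_teich, map_mul]
    ring
  have h2 : (p : O) ∣ η (1 - teich m * f) := by
    rw [map_sub, map_one, ← h1, sub_self]
    exact dvd_zero _
  rw [hη.p_dvd_iff, map_sub, map_one, map_mul, constantCoeff_teich, ← absF_le_absF_iff_dvd] at h2
  have h3 : absF p (m * WittVector.constantCoeff f) < absF p 1 := by
    rw [map_mul, map_one]
    exact mul_lt_one_of_lt_of_le hm1 (absF_le_one p _)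
  rw [Valuation.map_sub_eq_of_lt_left _ h3, map_one] at h2
  exact hη.lt_one.not_ge h2

end IsUntilt

end PthRoots

/-! ### Absolute values of theta values -/

section Theta

variable {K : Type*} [NormedField K]

theorem norm_eq_of_norm_sub_lt [IsUltrametricDist K] {x y : K}
    (h : ‖x - y‖ < ‖y‖) : ‖x‖ = ‖y‖ := by
  rw [← norm_neg y]
  refine IsUltrametricDist.norm_eq_of_add_norm_lt_max ?_
  rw [← sub_eq_add_neg, norm_neg]
  exact lt_max_of_lt_right h

theorem _root_.IsPrimitiveRoot.norm_eq_one_of_ne_zero {ζ : K} {ℓ : ℕ}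
    (hζ : IsPrimitiveRoot ζ ℓ) (hℓ : ℓ ≠ 0) : ‖ζ‖ = 1 := by
  rw [← pow_eq_one_iff_of_nonneg (norm_nonneg ζ) hℓ, ← norm_pow, hζ.pow_eq_one, norm_one]

theorem norm_tsum_sub_sum_le [IsUltrametricDist K] [CompleteSpace K] {ι : Type*} {f : ι → K} (hf : Summable f) (s : Finset ι) {C : ℝ}
    (hC : 0 ≤ C) (h : ∀ i ∉ s, ‖f i‖ ≤ C) : ‖∑' i, f i - ∑ i ∈ s, f i‖ ≤ C := by
  rw [← hf.sum_add_tsum_subtype_compl s, add_sub_cancel_left]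
  exact IsUltrametricDist.norm_tsum_le_of_forall_le_of_nonneg hC fun i => h i i.2

theorem summable_zpow_abs_sub_two {r : ℝ} (h0 : 0 < r) (h1 : r < 1) :
    Summable fun n : ℤ => r ^ (|n| - 2) := by
  have h : Summable fun n : ℕ => r ^ ((n : ℤ) - 2) := by
    have h2 : (fun n : ℕ => r ^ ((n : ℤ) - 2)) = fun n : ℕ => r ^ n * r ^ (-2 : ℤ) := by
      funext n
      rw [← zpow_natCast, ← zpow_add₀ h0.ne']
      rfl
    rw [h2]
    exact (summable_geometric_of_lt_one h0.le h1).mul_right _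
  rw [summable_int_iff_summable_nat_and_neg]
  exact ⟨by simpa using h, by simpa using h⟩

variable {q Q ζ : K} {ℓ : ℕ}

/-- The cases `k = 0` and `k = 1` serve the denominator `ϑ(ζ)` and the numerator `ϑ(Q ζ)`. -/
theorem norm_thetaM_term (hQ : Q ≠ 0) (hζ : ‖ζ‖ = 1) (hq : Q ^ (2 * ℓ) = q) (k n : ℤ) :
    ‖(-1) ^ n * q ^ (n * (n + 1) / 2) * (Q ^ k * ζ) ^ (2 * n + 1)‖
      = ‖Q‖ ^ (ℓ * (n * (n + 1)) + k * (2 * n + 1)) := by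
  have h2 := Int.two_mul_ediv_two_of_even (Int.even_mul_succ_self n)
  rw [norm_mul, norm_mul, norm_zpow, norm_zpow, norm_zpow, norm_mul, norm_neg, norm_one, one_zpow,
    one_mul, hζ, mul_one, ← hq, norm_pow, norm_zpow, ← zpow_natCast, ← zpow_mul, ← zpow_mul,
    ← zpow_add₀ (norm_ne_zero_iff.mpr hQ)]
  congr 2
  push_cast
  linear_combination (ℓ : ℤ) * h2

theorem summable_thetaM_term [CompleteSpace K] (hQ : Q ≠ 0) (hQ1 : ‖Q‖ < 1) (hζ : ‖ζ‖ = 1)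
    (hq : Q ^ (2 * ℓ) = q) (hℓ : 3 ≤ ℓ) {k : ℤ} (hk : k = 0 ∨ k = 1) :
    Summable fun n : ℤ => (-1) ^ n * q ^ (n * (n + 1) / 2) * (Q ^ k * ζ) ^ (2 * n + 1) := by
  refine Summable.of_norm_bounded
    (summable_zpow_abs_sub_two (norm_pos_iff.mpr hQ) hQ1) fun n => ?_
  rw [norm_thetaM_term hQ hζ hq]
  refine zpow_le_zpow_right_of_le_one₀ (norm_pos_iff.mpr hQ) hQ1.le ?_
  have h3 : 0 ≤ n * (n + 1) := by
    rcases le_or_gt 0 n with h | h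
    · positivity
    · nlinarith
  have h4 : (3 : ℤ) * (n * (n + 1)) ≤ ℓ * (n * (n + 1)) :=
    mul_le_mul_of_nonneg_right (by exact_mod_cast hℓ) h3
  rcases hk with rfl | rfl
  · rcases abs_cases n with ⟨h, h'⟩ | ⟨h, h'⟩ <;> rw [h] <;> nlinarith
  · rcases abs_cases n with ⟨h, h'⟩ | ⟨h, h'⟩ <;> rw [h]
    · nlinarith
    · obtain rfl | h5 : n = -1 ∨ n ≤ -2 := by omega
      · simp
      · nlinarith

/-- The powers of the primitive root `ζ ^ 2` sum to zero, so `-ℓ` is the sum of the `(ζ ^ 2) ^ i -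
1`, all multiples of `ζ ^ 2 - 1`. Since `|ℓ| = 1`, the latter cannot have norm less than `1`. -/
theorem norm_sub_inv_eq_one [IsUltrametricDist K] (hζ : IsPrimitiveRoot ζ ℓ) (hℓ : 3 ≤ ℓ) (hodd : Nat.Coprime 2 ℓ)
    (hℓ1 : ‖(ℓ : K)‖ = 1) : ‖ζ - ζ⁻¹‖ = 1 := by
  have hn : ‖ζ‖ = 1 := hζ.norm_eq_one_of_ne_zero (by omega)
  have hle : ∀ w : K, ‖w‖ = 1 → ‖w - 1‖ ≤ 1 := fun w hw =>
by
    rw [sub_eq_add_neg]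
    exact (IsUltrametricDist.norm_add_le_max w (-1)).trans (by rw [hw, norm_neg, norm_one, max_self])
  have hfac : ζ - ζ⁻¹ = ζ⁻¹ * (ζ ^ 2 - 1) := by
    have : ζ ≠ 0 := norm_ne_zero_iff.mp (by rw [hn]; exact one_ne_zero)
    field_simp
  have hn2 : ‖ζ ^ 2‖ = 1 := by rw [norm_pow, hn, one_pow]
  rw [hfac, norm_mul, norm_inv, hn, inv_one, one_mul]
  refine le_antisymm (hle _ hn2) (not_lt.mp fun hlt => ?_)
  have hprim : IsPrimitiveRoot (ζ ^ 2) ℓ := hζ.pow_of_coprime 2 hodd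
  have hsum := hprim.geom_sum_eq_zero (by omega)
  have h1 : ‖∑ i ∈ Finset.range ℓ, ((ζ ^ 2) ^ i - 1)‖ ≤ ‖ζ ^ 2 - 1‖ := by
    refine IsUltrametricDist.norm_sum_le_of_forall_le_of_nonneg (norm_nonneg _) fun i _ => ?_
    rw [← mul_geom_sum, norm_mul]
    refine mul_le_of_le_one_right (norm_nonneg _) ?_
    refine IsUltrametricDist.norm_sum_le_of_forall_le_of_nonneg zero_le_one fun j _ => ?_
    rw [norm_pow, hn2, one_pow]
  rw [Finset.sum_sub_distrib, hsum, Finset.sum_const, Finset.card_range, nsmul_eq_mul, mul_one,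
    zero_sub, norm_neg, hℓ1] at h1
  exact hlt.not_ge h1

/-- The terms `n = 0` and `n = -1` both have norm `1` and add up to `ζ - ζ⁻¹`; the others have norm
at most `|Q|`. -/
theorem norm_thetaM_eq_one [IsUltrametricDist K] [CompleteSpace K] (hQ : Q ≠ 0) (hQ1 : ‖Q‖ < 1) (hζ : IsPrimitiveRoot ζ ℓ)
    (hq : Q ^ (2 * ℓ) = q) (hℓ : 3 ≤ ℓ) (hodd : Nat.Coprime 2 ℓ) (hℓ1 : ‖(ℓ : K)‖ = 1) :
    ‖thetaM q ζ‖ = 1 := by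
  have hn : ‖ζ‖ = 1 := hζ.norm_eq_one_of_ne_zero (by omega)
  have hsum := summable_thetaM_term hQ hQ1 hn hq hℓ (k := 0) (Or.inl rfl)
  have hterm := norm_thetaM_term hQ hn hq 0
  simp only [zpow_zero, one_mul, zero_mul, add_zero] at hsum hterm
  have h := norm_tsum_sub_sum_le hsum {0, -1} (norm_nonneg Q) fun n hn => by
    rw [hterm]
    simp only [Finset.mem_insert, Finset.mem_singleton, not_or] at hn
    conv_rhs => rw [← zpow_one ‖Q‖]
    refine zpow_le_zpow_right_of_le_one₀ (norm_pos_iff.mpr hQ) hQ1.le ?_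
    have h1 : 1 ≤ n * (n + 1) := by
      rcases (by omega : 1 ≤ n ∨ n ≤ -2) with h | h <;> nlinarith
    have h2 : (1 : ℤ) ≤ ℓ := by exact_mod_cast (by omega : 1 ≤ ℓ)
    nlinarith
  rw [Finset.sum_pair (by norm_num)] at h
  have h2 : (-1 : K) ^ (0 : ℤ) * q ^ ((0 : ℤ) * (0 + 1) / 2) * ζ ^ (2 * (0 : ℤ) + 1) +
      (-1 : K) ^ (-1 : ℤ) * q ^ ((-1 : ℤ) * (-1 + 1) / 2) * ζ ^ (2 * (-1 : ℤ) + 1) = ζ - ζ⁻¹ := by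
    norm_num [zpow_neg]
    ring
  rw [h2] at h
  have h3 := norm_sub_inv_eq_one hζ hℓ hodd hℓ1
  have h4 := h.trans_lt hQ1
  rw [← h3] at h4 ⊢
  exact norm_eq_of_norm_sub_lt h4

/-- The exponent `ℓ n (n + 1) + 2 n + 1` is `-1` at `n = -1` and nonnegative elsewhere, so a single
term dominates. -/
theorem norm_thetaM_mul [IsUltrametricDist K] [CompleteSpace K] (hQ : Q ≠ 0) (hQ1 : ‖Q‖ < 1) (hζ : IsPrimitiveRoot ζ ℓ)
    (hq : Q ^ (2 * ℓ) = q) (hℓ : 3 ≤ ℓ) : ‖thetaM q (Q * ζ)‖ = ‖Q‖⁻¹ := by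
  have hn : ‖ζ‖ = 1 := hζ.norm_eq_one_of_ne_zero (by omega)
  have hsum := summable_thetaM_term hQ hQ1 hn hq hℓ (k := 1) (Or.inr rfl)
  have hterm := norm_thetaM_term hQ hn hq 1
  simp only [zpow_one, one_mul] at hsum hterm
  have h := norm_tsum_sub_sum_le hsum {-1} zero_le_one fun n hn => by
    rw [hterm]
    simp only [Finset.mem_singleton] at hn
    conv_rhs => rw [← zpow_zero ‖Q‖]
    refine zpow_le_zpow_right_of_le_one₀ (norm_pos_iff.mpr hQ) hQ1.le ?_
    have h1 : 0 ≤ n * (n + 1) := by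
      rcases (by omega : 0 ≤ n ∨ n ≤ -2) with h | h <;> nlinarith
    have h2 : (3 : ℤ) ≤ ℓ := by exact_mod_cast hℓ
    rcases (by omega : 0 ≤ n ∨ n ≤ -2) with h | h <;> nlinarith
  have h1 : 1 < ‖Q‖⁻¹ := (one_lt_inv₀ (norm_pos_iff.mpr hQ)).mpr hQ1
  have h2 := hterm (-1)
  simp only [Int.reduceNeg, neg_add_cancel, mul_zero, zero_add] at h2
  rw [Finset.sum_singleton] at h
  have h3 := h.trans_lt h1
  rw [← zpow_neg_one, show (-1 : ℤ) = 2 * -1 + 1 by norm_num, ← h2] at h3 ⊢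
  exact norm_eq_of_norm_sub_lt h3

theorem norm_thetaValue_le_one [IsUltrametricDist K] [CompleteSpace K] {ξ : K} (hQ : Q ≠ 0)
    (hQ1 : ‖Q‖ < 1) (hζ : IsPrimitiveRoot ζ ℓ) (hq : Q ^ (2 * ℓ) = q) (hℓ : 3 ≤ ℓ)
    (hodd : Nat.Coprime 2 ℓ) (hℓ1 : ‖(ℓ : K)‖ = 1) (hξ : IsThetaValue q Q ζ ξ) :
    ξ ≠ 0 ∧ ‖ξ‖ ≤ 1 := by
  have h : ‖ξ⁻¹‖ = ‖Q‖⁻¹ := by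
    rcases hξ with h | h
    · rw [h, norm_div, norm_thetaM_mul hQ hQ1 hζ hq hℓ,
        norm_thetaM_eq_one hQ hQ1 hζ hq hℓ hodd hℓ1, div_one]
    · rw [h, norm_neg, norm_mul, norm_inv, norm_pow, norm_inv,
        hζ.norm_eq_one_of_ne_zero (by omega), inv_one, one_pow, mul_one]
  rw [norm_inv, inv_inj] at h
  exact ⟨norm_ne_zero_iff.mp (h ▸ norm_ne_zero_iff.mpr hQ), h ▸ hQ1.le⟩

end Theta

/-! ### Lifts over `Σ_F` and the lower bound for the size -/

section Lifts

variable {p : ℕ} [Fact p.Prime]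

theorem teichCoord_one_zero : teichCoord (1 : Ainf p) 0 = 1 := by
  rw [teichCoord_eq_iff]; simp

theorem gaussW_one (ρ : Radius) : gaussW (absF p) ρ.toNN (1 : Ainf p) = 1 := by
  refine le_antisymm (ciSup_le fun n => mul_le_one' (absF_le_one p _)
    (pow_le_one₀ zero_le ρ.le_one)) ?_
  refine le_trans ?_ (le_gaussW (absF_le_one p) ρ.le_one (1 : Ainf p) 0)
  rw [teichCoord_one_zero]
  simp

theorem uniformContinuous_gaussSeminorm (ρ : Radius) :
    UniformContinuous (gaussSeminorm ρ : Bb p → ℝ) := by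
  have h : @UniformContinuous _ _ (uniformSpaceAt ρ) _ (gaussSeminorm ρ : Bb p → ℝ) :=
    letI := (gaussSeminorm (p := p) ρ).toSeminormedRing
    uniformContinuous_norm
  exact uniformContinuous_iInf_dom h

theorem normB_toB_teich (ρ : Radius) (x : OF p) : normB ρ (toB (teich x)) = absF p x := by
  have h : normB ρ (toB (teich x)) = gaussSeminorm ρ (algebraMap (Ainf p) (Bb p) (teich x)) :=
    UniformSpace.Completion.extension_coe (uniformContinuous_gaussSeminorm ρ) _
  rw [h, ← Localization.mk_one_eq_algebraMap]
  change (gaussBb ρ (Localization.mk (teich x) 1) : ℝ) = _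
  rw [gaussBb_mk, ← mul_one (teich x), gaussW_teichmuller_mul, Submonoid.coe_one, gaussW_one]
  simp

theorem zero_mem_tateModule (y : Point p) : 0 ∈ y.tateModule :=
  ⟨1, by simp, by simp [teich], by simp [logTeich, teich]⟩

variable {E : IntermediateField ℚ_[p] (PadicAlgCl p)}

theorem isUntilt_mk (y : Point p) (ι : Embedding E y) {a : OF p} (ha : a ≠ 0)
    (ha1 : absF p a < 1) (hy : y.ideal = Ideal.span {teich a - (p : Ainf p)}) :
    IsUntilt a (Ideal.Quotient.mk y.ideal) where
  ne_zero := ha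
  lt_one := ha1
  surjective := Ideal.Quotient.mk_surjective
  ker_eq := by rw [Ideal.mk_ker, hy]
  regular x hx := by
    -- The embedding of `E` makes `p` invertible in the total fraction ring; this gives regularity
    -- without knowing that `W(𝒪_F) / ℘` is a domain.
    have hp : IsUnit (p : y.residueField) := by
      have h : IsUnit (p : E) := isUnit_iff_ne_zero.mpr
        (by exact_mod_cast (Fact.out : p.Prime).ne_zero)
      simpa using h.map ι.toRingHom
    apply IsFractionRing.injective y.integers y.residueField
    rw [map_zero, ← hp.mul_right_eq_zero, ← map_natCast (algebraMap y.integers y.residueField),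
      ← map_mul, hx, map_zero]

theorem exists_isTeichLift {y : Point p} (ι : Embedding E y) {a : OF p} (ha : a ≠ 0)
    (ha1 : absF p a < 1) (hy : y.ideal = Ideal.span {teich a - (p : Ainf p)}) {ξ : E} (hξ : ξ ≠ 0)
    (hξ1 : ‖ξ‖ ≤ 1) {k : ℕ} (hk : ‖(p : E) ^ k‖ ≤ ‖ξ‖) :
    ∃ x, IsTeichLift ι ξ x ∧ absF p a ^ k ≤ absF p x := by
  have hη := isUntilt_mk y ι ha ha1 hy
  obtain ⟨c, hc⟩ := (ι.norm_le_one_iff ξ).mp hξ1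
  obtain ⟨w, hw⟩ := (ι.norm_le_one_iff ((p : E) ^ k / ξ)).mp (by
    change ‖(p : E) ^ k / ξ‖ ≤ 1
    rw [norm_div]
    exact div_le_one_of_le₀ hk (norm_nonneg _))
  have hcw : c ∣ (p : y.integers) ^ k := by
    refine ⟨w, IsFractionRing.injective y.integers y.residueField ?_⟩
    rw [map_mul, hc, hw, ← map_mul, mul_div_cancel₀ _ hξ]
    simp
  obtain ⟨x, hx⟩ := hη.exists_teich_eq_of_dvd hcw
  refine ⟨x, ?_, hη.absF_pow_le_of_dvd (hx ▸ hcw)⟩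
  change algebraMap _ _ (Ideal.Quotient.mk y.ideal (teich x)) = _
  rw [hx, hc]

theorem exists_lt_one_forall_le_pow {t : ℝ≥0} (ht : t < 1) (N : ℕ) :
    ∃ r < 1, ∀ s : ℝ≥0, r ≤ s → t ≤ s ^ N := by
  -- The root of order `N + 1` rather than `N` also covers `N = 0`.
  refine ⟨t ^ ((N + 1 : ℕ) : ℝ)⁻¹, NNReal.rpow_lt_one ht (by positivity), fun s hs => ?_⟩
  by_cases h : s ≤ 1
  · refine le_trans ?_ (pow_le_pow_of_le_one zero_le h N.le_succ)
    calc t = (t ^ ((N + 1 : ℕ) : ℝ)⁻¹) ^ (N + 1) := (NNReal.rpow_inv_natCast_pow t N.succ_ne_zero).symm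
      _ ≤ s ^ (N + 1) := pow_le_pow_left' hs _
  · exact ht.le.trans (one_le_pow₀ (not_le.mp h).le)

theorem le_sizeB_thetaTilde (n : ℕ) (ι : ∀ y : Point p, Embedding E y) {ξ : E} (hξ : ξ ≠ 0)
    (hξ1 : ‖ξ‖ ≤ 1) {t : ℝ≥0} (ht : t < 1) : ENNReal.ofReal t ≤ sizeB (thetaTilde n ι ξ) := by
  obtain ⟨k, hk⟩ : ∃ k : ℕ, ‖(p : E) ^ k‖ ≤ ‖ξ‖ := by
    have hp : ‖(p : E)‖ < 1 := by
      change ‖(p : PadicAlgCl p)‖ < 1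
      rw [← map_natCast (algebraMap ℚ_[p] (PadicAlgCl p)), PadicAlgCl.norm_extends]
      exact Padic.norm_p_lt_one
    obtain ⟨k, hk⟩ := exists_pow_lt_of_lt_one (norm_pos_iff.mpr hξ) hp
    exact ⟨k, by rw [norm_pow]; exact hk.le⟩
  -- The `j`-th point belongs to `a ^ (j + 1) ^ 2`, so its lift has absolute value at least `|a| ^
  -- ((j + 1) ^ 2 * k)`; the exponent here is the total over `j`.
  obtain ⟨r, hr, hrt⟩ := exists_lt_one_forall_le_pow ht (∑ j : Fin n, ((j : ℕ) + 1) ^ 2 * k)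
  obtain ⟨a, ha, ha1, har⟩ := exists_absF_gt (p := p) hr
  have haj : ∀ j : Fin n, absF p (a ^ ((j : ℕ) + 1) ^ 2) < 1 := fun j => by
    rw [map_pow]
    exact pow_lt_one₀ zero_le ha1 (by positivity)
  let y : Fin n → Point p := fun j =>
    ⟨Ideal.span {teich (a ^ ((j : ℕ) + 1) ^ 2) - (p : Ainf p)}, _, pow_ne_zero _ ha, haj j, rfl⟩
  choose x hx hxa using fun j =>
    exists_isTeichLift (ι (y j)) (pow_ne_zero _ ha) (haj j) rfl hξ hξ1 hk
  have hz : (fun j => toB (teich (x j)) + 0) ∈ thetaTilde n ι ξ := fun S hS =>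
    hS.1 y ⟨a, ha, ha1, fun _ => rfl⟩
      ⟨x, fun _ => 0, hx, fun j => zero_mem_tateModule (y j), rfl⟩
  -- Any radius would do, as Gauss norms of Teichmüller elements do not depend on it.
  let ρ : Radius := ⟨1 / 2, by norm_num, by norm_num⟩
  refine le_trans (ENNReal.ofReal_le_ofReal ?_) (le_iSup_of_le ρ (le_iSup₂_of_le _ hz le_rfl))
  simp only [add_zero, normB_toB_teich]
  have h : t ≤ ∏ j, absF p (x j) := by
    refine (hrt _ har.le).trans ?_
    rw [← Finset.prod_pow_eq_pow_sum]
    refine Finset.prod_le_prod' fun j _ => ?_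
    rw [pow_mul, ← map_pow]
    exact hxa j
  exact_mod_cast h

end Lifts

end
end FarguesFontaine

/-! ### The theorem -/

open FarguesFontaine in
theorem theorem10p1p1 :
    ∃ L : ℕ, ∀ (p : ℕ) [Fact p.Prime]
      (E : IntermediateField ℚ_[p] (PadicAlgCl p)) [FiniteDimensional ℚ_[p] E]
      (C : WeierstrassCurve E) [C.IsElliptic] (q : E), IsTateParameter C q →
      ∀ ℓ : ℕ, ℓ.Prime → 3 ≤ ℓ → ℓ ≠ p → L ≤ ℓ →
      ∀ Q ζ ξ : E, Q ^ (2 * ℓ) = q → IsPrimitiveRoot ζ ℓ → IsThetaValue q Q ζ ξ →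
      ∀ ι : ∀ y : Point p, Embedding E y,
        ENNReal.ofReal (‖((Q : PadicAlgCl p) : ℂ_[p])‖ ^ ((ℓ - 1) / 2)) ≤
          sizeB (thetaTilde ((ℓ - 1) / 2) ι ξ) := by
  refine ⟨0, ?_⟩
  intro p _ E _ C _ q hqC ℓ hℓ hℓ3 hℓp _ Q ζ ξ hQq hζ hξ ι
  obtain ⟨hq0, hq1, -⟩ := hqC
  have hQ : Q ≠ 0 := by
    rintro rfl
    exact hq0 (by rw [← hQq, zero_pow (by omega)])
  have hQ1 : ‖Q‖ < 1 := by
    have h : ‖q‖ < 1 := hq1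
    rw [← hQq, norm_pow] at h
    exact (pow_lt_one_iff_of_nonneg (norm_nonneg _) (by omega)).mp h
  have hℓ1 : ‖(ℓ : E)‖ = 1 := by
    change ‖(ℓ : PadicAlgCl p)‖ = 1
    rw [← map_natCast (algebraMap ℚ_[p] (PadicAlgCl p)), PadicAlgCl.norm_extends,
      Padic.norm_natCast_eq_one_iff]
    exact (Nat.coprime_primes Fact.out hℓ).mpr hℓp.symm
  have : CompleteSpace E := FiniteDimensional.complete ℚ_[p] E
  obtain ⟨hξ0, hξ1⟩ := norm_thetaValue_le_one hQ hQ1 hζ hQq hℓ3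
    ((Nat.coprime_primes Nat.prime_two hℓ).mpr (by omega)) hℓ1 hξ
  have hn : (ℓ - 1) / 2 ≠ 0 := by omega
  -- The claimed bound is itself a number `t < 1`, so it is one of those covered by
  -- `le_sizeB_thetaTilde`.
  have ht : ‖Q‖₊ ^ ((ℓ - 1) / 2) < 1 := pow_lt_one₀ zero_le (show ‖Q‖₊ < 1 from hQ1) hn
  have h := le_sizeB_thetaTilde ((ℓ - 1) / 2) ι hξ0 hξ1 ht
  rw [PadicComplex.norm_extends]
  simpa using h
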